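/- Let $K_0$ be a (non-archimedean) local field whose residue field has characteristic different from $2$, and let $\pi \in K_0$ be a parameter, i.e. a generator of the maximal ideal of the valuation ring of $K_0$. Fix an algebraic closure $\overline{K_0}$ of $K_0$ and an element $\sqrt{-1}\in\overline{K_0}$ with square $-1$. A field extension $E/F$ is called dihedral if it is Galois and $\mathrm{Gal}(E/F)$ is isomorphic to a dihedral group of order $2m$ for some $m \ge 2$. There is a maximum integer $d$ such that $K_0(\sqrt{-1})$ contains a primitive $2^d$-th root of unity, and for every integer $n \ge 2$ the following hold. (1) There exists a dihedral extension of $K_0$ of degree $2^{n+1}$ if and only if $\sqrt{-1} \notin K_0$ and $n < d$. (2) If $\sqrt{-1} \notin K_0$ and $n < d$, then for every $2^n$-th root $\sqrt[2^n]{\pi}\in\overline{K_0}$ of $\pi$, the field $K_0(\sqrt{-1}, \sqrt[2^n]{\pi})$ is a dihedral extension of $K_0$ of degree $2^{n+1}$, and every dihedral extension of $K_0$ of degree $2^{n+1}$ is isomorphic to it over $K_0$. -/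

import Mathlib

open scoped ValuativeRel IntermediateField

universe u

/-- A field extension `E / F` is dihedral if it is Galois and its Galois group is isomorphic to a
dihedral group of some order `2 * m ≥ 4` (so that `E / F` is automatically finite). -/
def IsDihedralExtension (F E : Type*) [Field F] [Field E] [Algebra F E] : Prop :=
  IsGalois F E ∧ ∃ m : ℕ, 2 ≤ m ∧ Nonempty ((E ≃ₐ[F] E) ≃* DihedralGroup m)

/-! Only the arithmetic of square classes in a tame local field `K` is needed. With `u` a nonsquare
unit, taken to be `-1` if `-1` is not a square, the classes are `1, u, π, uπ`, and norms from
`K(√u)` lie in the classes of `1` and `u`. These facts pass to a ramified quadratic extension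
`F(√ρ)`, with `√ρ` as the new parameter (`IsQuadraticStep.isTameSquareClassPairIn`).

Let `Gal(L/K)` be dihedral with a rotation `r` of order `2^n` and a reflection `s`. The fixed field
of `r` is `K(√u)` (`IsDihedralPair.exists_sq_eq`). Since `s` moves `√u`, the fixed fields of `⟨s,
r^(2^j)⟩` climb by ramified quadratic steps from `K` to the fixed field of `s`, and successive
square roots give `ρ` fixed by `s` with `ρ^(2^n) = u^k π`. Then `ζ = r(ρ)/ρ` is a primitive `2^n`-th
root of unity in `K(√u)`, since otherwise `u^k π` would be a norm, and `sr = r⁻¹s` says that `ζ` has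
norm `1`. So `s` inverts the power `i` of `ζ` of order `4`, whence `i ∉ K` and `u = -1`. By Hilbert
90, `ζ = y/s(y) = y²/N(y)`, and `N(y)` is a square in `K(i)`; thus `ζ = η²` with `η ∈ K(i)` of order
`2^(n+1)`, and `ρη^k` is a `2^n`-th root of `π`. A comparison of degrees identifies `L`.

Conversely, if `ξ ∈ K(i)` has order `2^(n+1)` and `i ∉ K`, the norm of `ξ` to `K` is `±1`, so powers
of `ξ²` have norm `1`. This is the relation that makes the Kummer rotation and the conjugation
generate a dihedral group. -/

/-- `u` and `π` together with `1` and `u * π` represent all square classes of `K`, the quaternion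
algebra `(u, π)` is not split, and the class of `u` behaves like that of a nonsquare unit of a
local field of odd residue characteristic. -/
structure IsTameSquareClassPair (K : Type*) [Field K] (u π : K) : Prop where
  two_ne_zero : (2 : K) ≠ 0
  left_ne_zero : u ≠ 0
  right_ne_zero : π ≠ 0
  exists_sq_class : ∀ x : K, x ≠ 0 →
    ∃ c, x = c ^ 2 ∨ x = u * c ^ 2 ∨ x = π * c ^ 2 ∨ x = u * π * c ^ 2
  norm_ne : ∀ x y : K, x ^ 2 - u * y ^ 2 ≠ π
  neg_one_norm : ∃ x y : K, x ^ 2 - u * y ^ 2 = -1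
  left_eq : u = -1 ∨ ∃ w : K, w ^ 2 = -1
  sq_class_of_pow_eq_one : ∀ (k : ℕ) (x : K), x ^ 2 ^ k = 1 → ∃ c, x = c ^ 2 ∨ x = u * c ^ 2

/-! ### Hensel's lemma, square classes and roots of unity over a discrete valuation ring -/

section Henselian

open IsLocalRing

theorem HenselianLocalRing.of_isAdicComplete (R : Type*) [CommRing R] [IsLocalRing R]
    [IsAdicComplete (maximalIdeal R) R] : HenselianLocalRing R where
  is_henselian f hf a h₁ h₂ :=
    (IsAdicComplete.henselianRing R (maximalIdeal R)).is_henselian f hf a h₁ (h₂.map _)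

theorem HenselianLocalRing.exists_sq_eq {R : Type*} [CommRing R] [HenselianLocalRing R]
    (h2 : IsUnit (2 : R)) {a : R} (ha : IsUnit a) {b : R} (hab : residue R a = residue R b ^ 2) :
    ∃ c, c ^ 2 = a := by
  have hb : IsUnit b := by
    rw [← residue_ne_zero_iff_isUnit]
    intro h
    rw [h, zero_pow two_ne_zero] at hab
    exact (residue_ne_zero_iff_isUnit a).2 ha hab
  obtain ⟨c, hc, -⟩ := HenselianLocalRing.is_henselian (Polynomial.X ^ 2 - Polynomial.C a)
    (Polynomial.monic_X_pow_sub_C a two_ne_zero) b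
    (by
      rw [← residue_eq_zero_iff]
      simp [hab])
    (by simpa [one_add_one_eq_two] using h2.mul hb)
  exact ⟨c, by simpa [sub_eq_zero] using hc⟩

theorem FiniteField.exists_sq_or_mul_sq {k : Type*} [Field k] [Finite k]
    {u : k} (hu : ¬ IsSquare u) (x : k) : ∃ c, x = c ^ 2 ∨ x = u * c ^ 2 := by
  classical
  have := Fintype.ofFinite k
  by_cases hx : IsSquare x
  · obtain ⟨c, rfl⟩ := hx
    exact ⟨c, .inl (sq c).symm⟩
  have hu0 : u ≠ 0 := fun h ↦ hu (h ▸ IsSquare.zero)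
  have h1 := quadraticChar_neg_one_iff_not_isSquare.2 hx
  have h2 := quadraticChar_neg_one_iff_not_isSquare.2 hu
  have hx0 : x ≠ 0 := fun h ↦ hx (h ▸ IsSquare.zero)
  have h3 : quadraticChar k (x * u) = 1 := by rw [map_mul, h1, h2]; norm_num
  obtain ⟨c, hc⟩ := (quadraticChar_one_iff_isSquare (mul_ne_zero hx0 hu0)).1 h3
  refine ⟨c / u, .inr ?_⟩
  field_simp
  rw [hc, sq]

theorem FiniteField.exists_sq_add_sq_eq_neg_one {k : Type*} [Field k] [Finite k]
    (hk : ringChar k ≠ 2) : ∃ a b : k, a ^ 2 + b ^ 2 = -1 := by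
  have := Fintype.ofFinite k
  obtain ⟨a, b, h⟩ := FiniteField.exists_root_sum_quadratic
    (f := (Polynomial.X ^ 2 : Polynomial k)) (g := Polynomial.X ^ 2 + Polynomial.C 1)
    (by simp) (by exact Polynomial.degree_X_pow_add_C (by norm_num) 1)
    (FiniteField.odd_card_of_char_ne_two hk)
  refine ⟨a, b, ?_⟩
  simp only [Polynomial.eval_pow, Polynomial.eval_X, Polynomial.eval_add, Polynomial.eval_C] at h
  linear_combination h

theorem IsLocalRing.isUnit_two_of_ringChar_ne {R : Type*} [CommRing R] [IsLocalRing R]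
    (h : ringChar (ResidueField R) ≠ 2) : IsUnit (2 : R) := by
  rw [← residue_ne_zero_iff_isUnit, map_ofNat]
  exact Ring.two_ne_zero h

theorem exists_unit_sq_class {R : Type*} [CommRing R] [HenselianLocalRing R]
    [Finite (ResidueField R)] (hchar : ringChar (ResidueField R) ≠ 2) {u : R}
    (hu : ¬ IsSquare (residue R u)) {x : R} (hx : IsUnit x) :
    ∃ c, x = c ^ 2 ∨ x = u * c ^ 2 := by
  have h2 := isUnit_two_of_ringChar_ne hchar
  have huu : IsUnit u := by
    rw [← residue_ne_zero_iff_isUnit]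
    exact fun h ↦ hu (h ▸ IsSquare.zero)
  obtain ⟨c, hc⟩ := FiniteField.exists_sq_or_mul_sq hu (residue R x)
  obtain ⟨c, rfl⟩ := residue_surjective c
  rcases hc with hc | hc
  · obtain ⟨d, hd⟩ := HenselianLocalRing.exists_sq_eq h2 hx hc
    exact ⟨d, .inl hd.symm⟩
  · obtain ⟨v, rfl⟩ := huu
    have h : residue R ((↑v⁻¹ : R) * x) = residue R c ^ 2 := by
      rw [map_mul, hc, ← mul_assoc, ← map_mul, Units.inv_mul, map_one, one_mul]
    obtain ⟨d, hd⟩ := HenselianLocalRing.exists_sq_eq h2 (v⁻¹.isUnit.mul hx) h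
    exact ⟨d, .inr (by rw [hd, Units.mul_inv_cancel_left])⟩

/-- Infinite descent: as `u` is not a square modulo `π`, divisibility of `x² - uy²` by `π` forces
`π` to divide both `x` and `y`, hence `z` too, and `π` cancels throughout. -/
theorem sq_sub_mul_sq_ne {R : Type*} [CommRing R] [IsDomain R] [IsDiscreteValuationRing R]
    {u : R} (hu : ¬ IsSquare (residue R u)) {π : R} (hπ : Irreducible π)
    (x y z : R) (hz : z ≠ 0) : x ^ 2 - u * y ^ 2 ≠ π * z ^ 2 := by
  have key : ∀ {x y : R}, π ∣ x ^ 2 - u * y ^ 2 → π ∣ x ∧ π ∣ y := by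
    intro x y h
    have hdvd : ∀ t : R, π ∣ t ↔ residue R t = 0 := fun t ↦ by
      rw [residue_eq_zero_iff, hπ.maximalIdeal_eq, Ideal.mem_span_singleton]
    rw [hdvd, hdvd]
    rw [hdvd, map_sub, map_mul, map_pow, map_pow, sub_eq_zero] at h
    by_cases hy : residue R y = 0
    · refine ⟨?_, hy⟩
      rw [hy] at h
      simpa using h
    · exact (hu ⟨residue R x / residue R y, by field_simp; rw [h]⟩).elim
  have hp : Prime π := hπ.prime
  suffices H : ∀ n : ℕ, ∀ x y z : R, x ^ 2 - u * y ^ 2 = π * z ^ 2 → π ^ n ∣ z by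
    intro h
    obtain ⟨n, hn⟩ := FiniteMultiplicity.of_prime_left hp hz
    exact hn (H _ x y z h)
  intro n
  induction n with
  | zero => simp
  | succ n ih =>
    intro x y z h
    obtain ⟨⟨x, rfl⟩, y, rfl⟩ := key ⟨z ^ 2, h⟩
    have h1 : π * (x ^ 2 - u * y ^ 2) = z ^ 2 :=
      mul_left_cancel₀ hp.ne_zero (by linear_combination h)
    obtain ⟨z, rfl⟩ := hp.dvd_of_dvd_pow ⟨_, h1.symm⟩
    have h2 : x ^ 2 - u * y ^ 2 = π * z ^ 2 :=
      mul_left_cancel₀ hp.ne_zero (by linear_combination h1)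
    rw [pow_succ']
    exact mul_dvd_mul_left _ (ih x y z h2)

theorem exists_isTameSquareClassPair {R : Type*} [CommRing R] [IsDomain R]
    [IsDiscreteValuationRing R] [HenselianLocalRing R] [Finite (ResidueField R)]
    (K : Type*) [Field K] [Algebra R K] [IsFractionRing R K]
    (hchar : ringChar (ResidueField R) ≠ 2) {π : R}
    (hπ : Irreducible π) : ∃ u : K, IsTameSquareClassPair K u (algebraMap R K π) := by
  classical
  have hinj := IsFractionRing.injective R K
  have hmap0 : ∀ x : R, algebraMap R K x = 0 ↔ x = 0 := fun x ↦
    map_eq_zero_iff _ hinj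
  have h2 := isUnit_two_of_ringChar_ne hchar
  -- If `-1` is a nonsquare in the residue field it is itself chosen as `u`; otherwise Hensel
  -- provides a square root of `-1` in `R`.
  obtain ⟨u, hu, hu'⟩ : ∃ u : R, ¬ IsSquare (residue R u) ∧
      (u = -1 ∨ ∃ w : R, w ^ 2 = -1) := by
    by_cases h : IsSquare (-1 : ResidueField R)
    · obtain ⟨w, hw⟩ := h
      obtain ⟨w, rfl⟩ := residue_surjective w
      obtain ⟨v, hv⟩ := FiniteField.exists_nonsquare hchar
      obtain ⟨v, rfl⟩ := residue_surjective v
      exact ⟨v, hv, .inr (HenselianLocalRing.exists_sq_eq h2 isUnit_one.neg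
        (b := w) (by simpa [sq] using hw))⟩
    · exact ⟨-1, by simpa using h, .inl rfl⟩
  have huu : IsUnit u := by
    rw [← residue_ne_zero_iff_isUnit]
    exact fun h ↦ hu (h ▸ IsSquare.zero)
  refine ⟨algebraMap R K u, ?_, ?_, ?_, ?_, ?_, ?_, ?_, ?_⟩
  · rw [← map_ofNat (algebraMap R K), Ne, hmap0]
    exact h2.ne_zero
  · rw [Ne, hmap0]; exact huu.ne_zero
  · rw [Ne, hmap0]; exact hπ.ne_zero
  · have hR : ∀ x : R, x ≠ 0 →
        ∃ c, x = c ^ 2 ∨ x = u * c ^ 2 ∨ x = π * c ^ 2 ∨ x = u * π * c ^ 2 := by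
      intro x hx
      obtain ⟨n, v, rfl⟩ := IsDiscreteValuationRing.eq_unit_mul_pow_irreducible hx hπ
      obtain ⟨c, hc⟩ := exists_unit_sq_class hchar hu v.isUnit
      obtain ⟨m, rfl | rfl⟩ := Nat.even_or_odd' n
      · refine ⟨c * π ^ m, ?_⟩
        rcases hc with hc | hc
        · left; rw [hc]; ring
        · right; left; rw [hc]; ring
      · refine ⟨c * π ^ m, ?_⟩
        rcases hc with hc | hc
        · right; right; left; rw [hc]; ring
        · right; right; right; rw [hc]; ring
    intro x hx
    obtain ⟨a, b, hb, rfl⟩ := IsFractionRing.div_surjective (A := R) x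
    have hb0 : b ≠ 0 := nonZeroDivisors.ne_zero hb
    have hb' : algebraMap R K b ≠ 0 := by rwa [Ne, hmap0]
    have ha0 : a ≠ 0 := by
      rintro rfl
      simp at hx
    obtain ⟨c, hc⟩ := hR (a * b) (mul_ne_zero ha0 hb0)
    refine ⟨algebraMap R K c / algebraMap R K b, ?_⟩
    have hab : algebraMap R K a / algebraMap R K b
      = algebraMap R K (a * b) / algebraMap R K b ^ 2 := by
      rw [map_mul]; field_simp
    rw [hab]
    rcases hc with hc | hc | hc | hc
    · left; rw [hc, map_pow, div_pow]
    · right; left; rw [hc]; simp only [map_mul, map_pow]; ring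
    · right; right; left; rw [hc]; simp only [map_mul, map_pow]; ring
    · right; right; right; rw [hc]; simp only [map_mul, map_pow]; ring
  · intro x y h
    obtain ⟨⟨b, hb⟩, hx, hy⟩ : ∃ b : nonZeroDivisors R,
        (∃ a : R, algebraMap R K a = x * algebraMap R K b) ∧
        (∃ a : R, algebraMap R K a = y * algebraMap R K b) := by
      obtain ⟨b, hb⟩ := IsLocalization.exist_integer_multiples_of_finset (nonZeroDivisors R)
        ({x, y} : Finset K)
      have hb' : ∀ z ∈ ({x, y} : Finset K), ∃ a : R, algebraMap R K a = z * algebraMap R K b := by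
        intro z hz
        obtain ⟨a, ha⟩ := hb z hz
        exact ⟨a, by rw [ha, Algebra.smul_def, mul_comm]⟩
      exact ⟨b, hb' x (by simp), hb' y (by simp)⟩
    obtain ⟨x', hx⟩ := hx
    obtain ⟨y', hy⟩ := hy
    refine sq_sub_mul_sq_ne hu hπ x' y' b (nonZeroDivisors.ne_zero hb) (hinj ?_)
    simp only [map_sub, map_mul, map_pow, hx, hy]
    linear_combination algebraMap R K b ^ 2 * h
  · rcases hu' with rfl | ⟨w, hw⟩
    -- The norm form is `x² + y²`. A residual solution of `a² + b² = -1` has `b ≠ 0`, as `-1` is not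
    -- a square, so Hensel lifts `b` to a square root of `-1 - a²`.
    · obtain ⟨a, b, hab⟩ := FiniteField.exists_sq_add_sq_eq_neg_one hchar
      obtain ⟨a, rfl⟩ := residue_surjective a
      obtain ⟨b, rfl⟩ := residue_surjective b
      have hb : residue R b ≠ 0 := by
        intro h
        rw [h] at hab
        exact hu ⟨residue R a, by simpa [sq] using hab.symm⟩
      have hr : residue R (-1 - a ^ 2) = residue R b ^ 2 := by
        simp only [map_sub, map_neg, map_one, map_pow]
        linear_combination -hab
      obtain ⟨c, hc⟩ := HenselianLocalRing.exists_sq_eq h2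
        (by rw [← residue_ne_zero_iff_isUnit, hr]; exact pow_ne_zero 2 hb) hr
      refine ⟨algebraMap R K a, algebraMap R K c, ?_⟩
      have := congrArg (algebraMap R K) hc
      simp only [map_sub, map_neg, map_one, map_pow] at this ⊢
      linear_combination this
    · refine ⟨algebraMap R K w, 0, ?_⟩
      rw [← map_pow, hw]
      simp
  · rcases hu' with rfl | ⟨w, hw⟩
    · left; simp
    · right; exact ⟨algebraMap R K w, by rw [← map_pow, hw]; simp⟩
  · intro k x hx
    obtain ⟨y, rfl⟩ : ∃ y : R, algebraMap R K y = x := IsIntegrallyClosed.isIntegral_iff.1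
      (IsIntegral.of_pow (n := 2 ^ k) (by positivity) (by rw [hx]; exact isIntegral_one))
    have hy : y ^ 2 ^ k = 1 := hinj (by rw [map_pow, hx, map_one])
    obtain ⟨c, hc⟩ := exists_unit_sq_class hchar hu
      (IsUnit.of_pow_eq_one hy (by positivity))
    exact ⟨algebraMap R K c, hc.imp (by rintro rfl; simp) (by rintro rfl; simp)⟩

/-- A finite separable extension of the fraction field of a discrete valuation ring with finite
residue field of odd characteristic has only finitely many roots of unity of 2-power order. -/
theorem exists_bound_isPrimitiveRoot_two_pow {R : Type*} [CommRing R] [IsDomain R]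
    [IsDiscreteValuationRing R] [Finite (ResidueField R)] {K : Type*} [Field K] [Algebra R K]
    [IsFractionRing R K] (hchar : ringChar (ResidueField R) ≠ 2) (L : Type*) [Field L]
    [Algebra K L] [FiniteDimensional K L] [Algebra.IsSeparable K L] :
    ∃ N : ℕ, ∀ k (ζ : L), IsPrimitiveRoot ζ (2 ^ k) → k ≤ N := by
  let : Algebra R L := Algebra.compHom L (algebraMap R K)
  have : IsScalarTower R K L := IsScalarTower.of_algebraMap_eq fun _ ↦ rfl
  let B := integralClosure R L
  have : Module.Finite R B := IsIntegralClosure.finite R K L B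
  have : FaithfulSMul R L := by
    rw [faithfulSMul_iff_algebraMap_injective, IsScalarTower.algebraMap_eq R K L]
    exact (algebraMap K L).injective.comp (IsFractionRing.injective R K)
  have : FaithfulSMul R B := by
    rw [faithfulSMul_iff_algebraMap_injective]
    intro x y h
    exact FaithfulSMul.algebraMap_injective R L (congrArg (algebraMap B L) h)
  obtain ⟨P, hP, hPl⟩ := Ideal.exists_maximal_ideal_liesOver_of_isIntegral (S := B)
    (maximalIdeal R)
  have : Finite (R ⧸ maximalIdeal R) := inferInstanceAs (Finite (ResidueField R))
  have : Finite (B ⧸ P) := Module.finite_of_finite (R ⧸ maximalIdeal R)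
  have h2 : IsUnit (2 : B ⧸ P) := by
    have := (isUnit_two_of_ringChar_ne (R := R) hchar).map (algebraMap R (B ⧸ P))
    rwa [map_ofNat] at this
  have : Nontrivial (B ⧸ P) := Ideal.Quotient.nontrivial_iff.2 hP.ne_top
  refine ⟨Nat.card (B ⧸ P), fun k ζ hζ ↦ ?_⟩
  rcases k with _ | k
  · simp
  obtain ⟨z, rfl⟩ : ∃ z : B, algebraMap B L z = ζ :=
    ⟨⟨ζ, IsIntegral.of_pow (n := 2 ^ (k + 1)) (by positivity)
      (by rw [hζ.pow_eq_one]; exact isIntegral_one)⟩, rfl⟩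
  have hz : IsPrimitiveRoot z (2 ^ (k + 1)) := hζ.of_map_of_injective Subtype.val_injective
  have hneg : z ^ 2 ^ k = -1 := by
    have := hz.pow (by positivity) (pow_succ 2 k)
    exact this.eq_neg_one_of_two_right
  -- Reduction modulo `P` preserves the order because `-1 ≠ 1` in odd residue characteristic; the
  -- finite residue ring then bounds it.
  have hord : orderOf (Ideal.Quotient.mk P z) = 2 ^ (k + 1) := by
    refine orderOf_eq_prime_pow ?_ ?_
    · rw [← map_pow, hneg, map_neg, map_one]
      intro h
      apply h2.ne_zero
      linear_combination -h
    · rw [← map_pow, hz.pow_eq_one, map_one]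
  calc k + 1 ≤ 2 ^ (k + 1) := Nat.lt_two_pow_self.le
    _ = orderOf (Ideal.Quotient.mk P z) := hord.symm
    _ ≤ Nat.card (B ⧸ P) := orderOf_le_card

end Henselian

theorem IsNonarchimedeanLocalField.henselianLocalRing_integer (K : Type*) [Field K]
    [ValuativeRel K] [TopologicalSpace K] [IsNonarchimedeanLocalField K] :
    HenselianLocalRing 𝒪[K] := by
  let := IsTopologicalAddGroup.rightUniformSpace K
  have := isUniformAddGroup_of_addCommGroup (G := K)
  exact HenselianLocalRing.of_isAdicComplete 𝒪[K]

/-! ### Square classes and norms in quadratic extensions -/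

section TameTower

variable {K L : Type*} [Field K] [Field L] [Algebra K L]

/-- A version of `IsTameSquareClassPair` for an intermediate field. -/
structure IsTameSquareClassPairIn (F : IntermediateField K L) (u ρ : L) : Prop where
  two_ne_zero : (2 : L) ≠ 0
  left_mem : u ∈ F
  right_mem : ρ ∈ F
  left_ne_zero : u ≠ 0
  right_ne_zero : ρ ≠ 0
  exists_sq_class : ∀ x ∈ F, x ≠ 0 →
    ∃ c ∈ F, x = c ^ 2 ∨ x = u * c ^ 2 ∨ x = ρ * c ^ 2 ∨ x = u * ρ * c ^ 2
  norm_ne : ∀ x ∈ F, ∀ y ∈ F, x ^ 2 - u * y ^ 2 ≠ ρ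
  neg_one_norm : ∃ x ∈ F, ∃ y ∈ F, x ^ 2 - u * y ^ 2 = -1
  left_eq : u = -1 ∨ ∃ w ∈ F, w ^ 2 = -1

/-- The automorphism `σ` restricts to the nontrivial automorphism of the quadratic extension
`E / F`, and `δ` is a nonzero element of `E` on which it acts as `-1`. -/
structure IsQuadraticStep (F E : IntermediateField K L) (σ : L ≃ₐ[K] L) (δ : L) : Prop where
  le : F ≤ E
  map_mem : ∀ x ∈ E, σ x ∈ E
  apply_apply : ∀ x ∈ E, σ (σ x) = x
  apply_eq_iff : ∀ x ∈ E, σ x = x ↔ x ∈ F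
  mem : δ ∈ E
  ne_zero : δ ≠ 0
  apply_eq_neg : σ δ = -δ

variable {F E : IntermediateField K L} {σ : L ≃ₐ[K] L} {δ u ρ : L}

namespace IsTameSquareClassPairIn

/-- If `u` were a square, `x² - uy²` would be a hyperbolic plane and would represent `ρ = ((ρ+1)/2)²
- ((ρ-1)/2)²`. -/
theorem left_ne_sq (h : IsTameSquareClassPairIn F u ρ) {x : L} (hx : x ∈ F) : x ^ 2 ≠ u := by
  intro hxu
  have h2 := h.two_ne_zero
  have hx0 : x ≠ 0 := by
    rintro rfl
    exact h.left_ne_zero (by rw [← hxu]; simp)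
  have h2F : (2 : L) ∈ F := ofNat_mem F 2
  refine h.norm_ne ((ρ + 1) / 2) (F.div_mem (F.add_mem h.right_mem F.one_mem) h2F)
    ((ρ - 1) / 2 / x) (F.div_mem (F.div_mem (F.sub_mem h.right_mem F.one_mem) h2F) hx) ?_
  rw [← hxu]
  field_simp
  ring

/-- Both `-1` and `-u = N(√u)` are norms, hence so is `u`. If `uρ = N(x + y√u)`, then `ρ` is the
norm of `(x + y√u)(a + b√u)√u / u`, where `N(a + b√u) = -1`. -/
theorem mul_right (h : IsTameSquareClassPairIn F u ρ) : IsTameSquareClassPairIn F u (u * ρ) := by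
  have hu := h.left_ne_zero
  refine ⟨h.two_ne_zero, h.left_mem, F.mul_mem h.left_mem h.right_mem, h.left_ne_zero,
    mul_ne_zero h.left_ne_zero h.right_ne_zero, ?_, ?_, h.neg_one_norm, h.left_eq⟩
  · intro x hx hx0
    obtain ⟨c, hc, rfl | rfl | rfl | rfl⟩ := h.exists_sq_class x hx hx0
    · exact ⟨c, hc, .inl rfl⟩
    · exact ⟨c, hc, .inr (.inl rfl)⟩
    · exact ⟨c / u, F.div_mem hc h.left_mem, .inr (.inr (.inr (by field_simp)))⟩
    · exact ⟨c, hc, .inr (.inr (.inl rfl))⟩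
  · intro x hx y hy hxy
    obtain ⟨a, ha, b, hb, hab⟩ := h.neg_one_norm
    have hum := h.left_mem
    refine h.norm_ne ((u * b * x + u * a * y) / u) ?_ ((u * b * y + a * x) / u) ?_ ?_
    · exact F.div_mem (F.add_mem (F.mul_mem (F.mul_mem hum hb) hx)
        (F.mul_mem (F.mul_mem hum ha) hy)) hum
    · exact F.div_mem (F.add_mem (F.mul_mem (F.mul_mem hum hb) hy) (F.mul_mem ha hx)) hum
    · rw [div_pow, div_pow, mul_div_assoc', ← sub_div, div_eq_iff (pow_ne_zero 2 hu)]
      linear_combination (-u * (x ^ 2 - u * y ^ 2)) * hab + u * hxy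

end IsTameSquareClassPairIn

namespace IsQuadraticStep

theorem mul_conj_mem (h : IsQuadraticStep F E σ δ) {x : L} (hx : x ∈ E) : x * σ x ∈ F := by
  rw [← h.apply_eq_iff _ (E.mul_mem hx (h.map_mem x hx)), map_mul, h.apply_apply x hx, mul_comm]

theorem apply_of_mem (h : IsQuadraticStep F E σ δ) {x : L} (hx : x ∈ F) : σ x = x :=
  (h.apply_eq_iff x (h.le hx)).2 hx

theorem sq_mem (h : IsQuadraticStep F E σ δ) : δ ^ 2 ∈ F := by
  rw [← h.apply_eq_iff _ (pow_mem h.mem 2), map_pow, h.apply_eq_neg, neg_sq]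

theorem exists_eq_add_mul (h : IsQuadraticStep F E σ δ) (h2 : (2 : L) ≠ 0) {x : L} (hx : x ∈ E) :
    ∃ a ∈ F, ∃ b ∈ F, x = a + b * δ := by
  have h2E : (2 : L) ∈ E := ofNat_mem E 2
  have hδ := h.ne_zero
  refine ⟨(x + σ x) / 2, ?_, (x - σ x) / (2 * δ), ?_, by field_simp; ring⟩
  · rw [← h.apply_eq_iff _ (E.div_mem (E.add_mem hx (h.map_mem x hx)) h2E)]
    rw [map_div₀, map_add, h.apply_apply x hx, map_ofNat, add_comm]
  · rw [← h.apply_eq_iff _ (E.div_mem (E.sub_mem hx (h.map_mem x hx)) (E.mul_mem h2E h.mem))]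
    rw [map_div₀, map_sub, h.apply_apply x hx, map_mul, map_ofNat, h.apply_eq_neg]
    field_simp
    ring

/-- Hilbert's theorem 90 for a quadratic extension, up to scaling. -/
theorem exists_mul_apply_eq (h : IsQuadraticStep F E σ δ) {x c : L} (hx : x ∈ E) (hc : c ∈ F)
    (hxc : x * σ x = c ^ 2) : ∃ y ∈ E, y ≠ 0 ∧ x * σ y = c * y := by
  by_cases hxc' : x + c = 0
  · refine ⟨δ, h.mem, h.ne_zero, ?_⟩
    rw [h.apply_eq_neg]
    linear_combination -δ * hxc'
  · refine ⟨x + c, E.add_mem hx (h.le hc), hxc', ?_⟩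
    rw [map_add, h.apply_of_mem hc]
    linear_combination hxc

/-- By Hilbert 90, `x = c·y/σ(y) = c·N(y)·(y/N(y))²`, and `c·N(y)` lies in `F`. -/
theorem exists_eq_mul_sq (h : IsQuadraticStep F E σ δ) {x c : L} (hx : x ∈ E) (hc : c ∈ F)
    (hxc : x * σ x = c ^ 2) : ∃ f ∈ F, ∃ e ∈ E, x = f * e ^ 2 := by
  obtain ⟨y, hy, hy0, hxy⟩ := h.exists_mul_apply_eq hx hc hxc
  have hσy : σ y ≠ 0 := by simpa using hy0
  refine ⟨c * (y * σ y), F.mul_mem hc (h.mul_conj_mem hy), y / (y * σ y),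
    E.div_mem hy (h.le (h.mul_conj_mem hy)), ?_⟩
  field_simp
  linear_combination hxy

/-- In a ramified quadratic extension, `u` is not a norm. -/
theorem mul_conj_ne (h : IsQuadraticStep F E σ δ) (hF : IsTameSquareClassPairIn F u (δ ^ 2))
    {x c : L} (hx : x ∈ E) (hc : c ∈ F) (hc0 : c ≠ 0) : x * σ x ≠ u * c ^ 2 := by
  intro hxc
  obtain ⟨X, hX, Y, hY, rfl⟩ := h.exists_eq_add_mul hF.two_ne_zero hx
  rw [map_add, map_mul, h.apply_of_mem hX, h.apply_of_mem hY, h.apply_eq_neg] at hxc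
  by_cases hY0 : Y = 0
  · refine hF.left_ne_sq (F.div_mem hX hc) ?_
    subst hY0
    field_simp
    linear_combination hxc
  -- The equation `X² - δ²Y² = uc²`, solved for `δ²`, exhibits `δ²` as a norm from `F(√u)`.
  · refine hF.norm_ne (X / Y) (F.div_mem hX hY) (c / Y) (F.div_mem hc hY) ?_
    field_simp
    linear_combination hxc

/-- The class of `x` is read off from that of `N(x) ∈ F`. A square norm gives `x = fe²` with `f ∈
F`, where `δ²` has become a square. As `N(δ) = -δ²`, a norm in the class of `-δ²` reduces to this
after multiplication by `δ`. The other two classes would make `u` times a square a norm; which of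
`δ²`, `uδ²` is excluded depends on whether `u = -1` or `-1` is a square. -/
theorem isTameSquareClassPairIn (h : IsQuadraticStep F E σ δ)
    (hF : IsTameSquareClassPairIn F u (δ ^ 2)) : IsTameSquareClassPairIn E u δ := by
  have hδ := h.ne_zero
  have hσu := h.apply_of_mem hF.left_mem
  have huE := h.le hF.left_mem
  refine ⟨hF.two_ne_zero, huE, h.mem, hF.left_ne_zero, hδ, ?_, ?_, ?_, ?_⟩
  · have hsq : ∀ x ∈ E, ∀ c ∈ F, c ≠ 0 → x * σ x = c ^ 2 →
        ∃ e ∈ E, x = e ^ 2 ∨ x = u * e ^ 2 := by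
      intro x hx c hc hc0 hxc
      obtain ⟨f, hf, e, he, rfl⟩ := h.exists_eq_mul_sq hx hc hxc
      have hf0 : f ≠ 0 := by
        rintro rfl
        apply pow_ne_zero 2 hc0
        rw [← hxc]
        simp
      obtain ⟨d, hd, rfl | rfl | rfl | rfl⟩ := hF.exists_sq_class f hf hf0
      · exact ⟨d * e, E.mul_mem (h.le hd) he, .inl (by ring)⟩
      · exact ⟨d * e, E.mul_mem (h.le hd) he, .inr (by ring)⟩
      · exact ⟨δ * d * e, E.mul_mem (E.mul_mem h.mem (h.le hd)) he, .inl (by ring)⟩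
      · exact ⟨δ * d * e, E.mul_mem (E.mul_mem h.mem (h.le hd)) he, .inr (by ring)⟩
    have hsq' : ∀ x ∈ E, x ≠ 0 → ∀ c ∈ F, c ≠ 0 → x * σ x = -δ ^ 2 * c ^ 2 →
        ∃ e ∈ E, x = δ * e ^ 2 ∨ x = u * δ * e ^ 2 := by
      intro x hx hx0 c hc hc0 hxc
      obtain ⟨e, he, hxe⟩ := hsq (x * δ) (E.mul_mem hx h.mem) (δ ^ 2 * c)
        (F.mul_mem h.sq_mem hc) (mul_ne_zero (pow_ne_zero 2 hδ) hc0) (by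
          rw [map_mul, h.apply_eq_neg]
          linear_combination -δ ^ 2 * hxc)
      refine ⟨e / δ, E.div_mem he h.mem, ?_⟩
      refine hxe.imp (fun hxe ↦ ?_) (fun hxe ↦ ?_) <;>
      · field_simp
        linear_combination hxe
    intro x hx hx0
    have hN0 : x * σ x ≠ 0 := mul_ne_zero hx0 (by simpa using hx0)
    obtain ⟨c, hc, hxc⟩ := hF.exists_sq_class _ (h.mul_conj_mem hx) hN0
    have hc0 : c ≠ 0 := by
      rintro rfl
      apply hN0
      rcases hxc with hxc | hxc | hxc | hxc <;> rw [hxc] <;> simp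
    have hconj : x * δ * σ (x * δ) = - δ ^ 2 * (x * σ x) := by
      rw [map_mul, h.apply_eq_neg]; ring
    have hδc : δ ^ 2 * c ∈ F := F.mul_mem h.sq_mem hc
    have hδc0 : δ ^ 2 * c ≠ 0 := mul_ne_zero (pow_ne_zero 2 hδ) hc0
    rcases hxc with hxc | hxc | hxc | hxc
    · obtain ⟨e, he, hxe⟩ := hsq x hx c hc hc0 hxc
      exact ⟨e, he, by tauto⟩
    · exact (h.mul_conj_ne hF hx hc hc0 hxc).elim
    · rcases hF.left_eq with rfl | ⟨w, hw, hw2⟩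
      · refine (h.mul_conj_ne hF (E.mul_mem hx h.mem) hδc hδc0 ?_).elim
        rw [hconj, hxc]
        ring
      · obtain ⟨e, he, hxe⟩ := hsq' x hx hx0 (w * c) (F.mul_mem hw hc)
          (mul_ne_zero (fun h0 ↦ by simp [h0] at hw2) hc0)
          (by rw [hxc]; linear_combination δ ^ 2 * c ^ 2 * hw2)
        exact ⟨e, he, by tauto⟩
    · rcases hF.left_eq with rfl | ⟨w, hw, hw2⟩
      · obtain ⟨e, he, hxe⟩ := hsq' x hx hx0 c hc hc0 (by rw [hxc]; ring)
        exact ⟨e, he, by tauto⟩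
      · refine (h.mul_conj_ne hF (E.mul_mem hx h.mem) (F.mul_mem hw hδc)
          (mul_ne_zero (fun h0 ↦ by simp [h0] at hw2) hδc0) ?_).elim
        rw [hconj, hxc]
        linear_combination -u * δ ^ 4 * c ^ 2 * hw2
  · intro x hx y hy hxy
    obtain ⟨a, ha, b, hb, hab⟩ := hF.neg_one_norm
    have hσ := congrArg σ hxy
    rw [map_sub, map_mul, map_pow, map_pow, hσu, h.apply_eq_neg] at hσ
    -- Multiplying `x² - uy² = δ` by its conjugate gives `X² - uY² = -δ²` over `F`; since `-1` is
    -- also a norm, so is `δ²`, a contradiction.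
    set X := x * σ x + u * (y * σ y) with hX
    set Y := x * σ y + y * σ x with hY
    have hXF : X ∈ F := F.add_mem (h.mul_conj_mem hx) (F.mul_mem hF.left_mem (h.mul_conj_mem hy))
    have hYF : Y ∈ F := by
      rw [← h.apply_eq_iff _ (E.add_mem (E.mul_mem hx (h.map_mem y hy))
        (E.mul_mem hy (h.map_mem x hx))), map_add, map_mul, map_mul, h.apply_apply x hx,
        h.apply_apply y hy]
      ring
    refine hF.norm_ne (a * X + u * b * Y)
      (F.add_mem (F.mul_mem ha hXF) (F.mul_mem (F.mul_mem hF.left_mem hb) hYF)) (a * Y + b * X)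
      (F.add_mem (F.mul_mem ha hYF) (F.mul_mem hb hXF)) ?_
    have h1 : X ^ 2 - u * Y ^ 2 = -δ ^ 2 := by
      have : X ^ 2 - u * Y ^ 2 = (x ^ 2 - u * y ^ 2) * (σ x ^ 2 - u * σ y ^ 2) := by
        rw [hX, hY]; ring
      rw [this, hxy, hσ]
      ring
    linear_combination (X ^ 2 - u * Y ^ 2) * hab - h1
  · obtain ⟨a, ha, b, hb, hab⟩ := hF.neg_one_norm
    exact ⟨a, h.le ha, b, h.le hb, hab⟩
  · exact hF.left_eq.imp_right fun ⟨w, hw, hw2⟩ ↦ ⟨w, h.le hw, hw2⟩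

/-- In the unramified quadratic extension, the class of `ρ` does not contain norms. -/
theorem mul_conj_ne_mul_right (h : IsQuadraticStep F E σ δ) (hδ : δ ^ 2 = u)
    (hF : IsTameSquareClassPairIn F u ρ) {x c : L} (hx : x ∈ E) (hc : c ∈ F) (hc0 : c ≠ 0) :
    x * σ x ≠ ρ * c ^ 2 := by
  intro hxc
  obtain ⟨X, hX, Y, hY, rfl⟩ := h.exists_eq_add_mul hF.two_ne_zero hx
  rw [map_add, map_mul, h.apply_of_mem hX, h.apply_of_mem hY, h.apply_eq_neg] at hxc
  refine hF.norm_ne (X / c) (F.div_mem hX hc) (Y / c) (F.div_mem hY hc) ?_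
  field_simp
  linear_combination hxc + Y ^ 2 * hδ

theorem exists_mul_conj_eq (h : IsQuadraticStep F E σ δ) (hδ : δ ^ 2 = u)
    (hF : IsTameSquareClassPairIn F u ρ) {x : L} (hx : x ∈ E) (hx0 : x ≠ 0) :
    ∃ c ∈ F, c ≠ 0 ∧ (x * σ x = c ^ 2 ∨ x * σ x = u * c ^ 2) := by
  have hN0 : x * σ x ≠ 0 := mul_ne_zero hx0 (by simpa using hx0)
  obtain ⟨c, hc, hxc⟩ := hF.exists_sq_class _ (h.mul_conj_mem hx) hN0
  have hc0 : c ≠ 0 := by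
    rintro rfl
    apply hN0
    rcases hxc with hxc | hxc | hxc | hxc <;> rw [hxc] <;> simp
  rcases hxc with hxc | hxc | hxc | hxc
  · exact ⟨c, hc, hc0, .inl hxc⟩
  · exact ⟨c, hc, hc0, .inr hxc⟩
  · exact (h.mul_conj_ne_mul_right hδ hF hx hc hc0 hxc).elim
  · exact (h.mul_conj_ne_mul_right hδ hF.mul_right hx hc hc0 hxc).elim

/-- Norms from `F(√u)` lie in the classes of `1` and `u`, and `u = δ²` is a square upstairs. -/
theorem exists_mul_conj_eq_sq (h : IsQuadraticStep F E σ δ) (hδ : δ ^ 2 = u)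
    (hF : IsTameSquareClassPairIn F u ρ) {x : L} (hx : x ∈ E) (hx0 : x ≠ 0) :
    ∃ c ∈ E, c ≠ 0 ∧ x * σ x = c ^ 2 := by
  obtain ⟨c, hc, hc0, hxc | hxc⟩ := h.exists_mul_conj_eq hδ hF hx hx0
  · exact ⟨c, h.le hc, hc0, hxc⟩
  · exact ⟨δ * c, E.mul_mem h.mem (h.le hc), mul_ne_zero h.ne_zero hc0, by
      rw [hxc, mul_pow, hδ]⟩

end IsQuadraticStep

end TameTower

/-! ### Dihedral 2-groups by generators and relations -/

/-- Generators `r`, `s` of a dihedral group of order `2 ^ (n + 1)`, with the relations and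
nonrelations used below. -/
structure IsDihedralPair {G : Type*} [Group G] (n : ℕ) (r s : G) : Prop where
  pow_eq_one : r ^ 2 ^ n = 1
  mul_self : s * s = 1
  mul_eq : s * r = r⁻¹ * s
  closure_eq_top : Subgroup.closure {s, r} = ⊤
  pow_notMem : ∀ j < n, r ^ 2 ^ j ∉ Subgroup.closure {s, r ^ 2 ^ (j + 1)}
  notMem : s ∉ Subgroup.closure {r}

theorem DihedralGroup.isDihedralPair (n : ℕ) (i : ZMod (2 ^ n)) :
    IsDihedralPair n (DihedralGroup.r (1 : ZMod (2 ^ n))) (DihedralGroup.sr i) where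
  pow_eq_one := by simp
  mul_self := by simp
  mul_eq := by simp
  closure_eq_top := by
    rw [eq_top_iff]
    have hr : ∀ j : ZMod (2 ^ n), DihedralGroup.r j ∈
        Subgroup.closure {DihedralGroup.sr i, DihedralGroup.r 1} := by
      intro j
      have : DihedralGroup.r j = DihedralGroup.r 1 ^ j.val := by simp
      rw [this]
      exact pow_mem (Subgroup.subset_closure (by simp)) _
    rintro (j | j) -
    · exact hr j
    · have : DihedralGroup.sr j = DihedralGroup.sr i * DihedralGroup.r (j - i) := by simp
      rw [this]
      exact mul_mem (Subgroup.subset_closure (by simp)) (hr _)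
  pow_notMem := by
    intro j hj hmem
    -- An explicit dihedral subgroup, of rotations by multiples of `2^(j+1)`, contains both
    -- generators but not the rotation by `2^j`.
    let H : Subgroup (DihedralGroup (2 ^ n)) :=
      { carrier := {g | ∃ k, g = .r (2 ^ (j + 1) * k) ∨ g = .sr (i + 2 ^ (j + 1) * k)}
        one_mem' := ⟨0, .inl (by simp)⟩
        mul_mem' := by
          rintro _ _ ⟨k, rfl | rfl⟩ ⟨l, rfl | rfl⟩
          · exact ⟨k + l, .inl (by simp [mul_add])⟩
          · exact ⟨l - k, .inr (by simp only [DihedralGroup.r_mul_sr]; congr 1; ring)⟩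
          · exact ⟨k + l, .inr (by simp only [DihedralGroup.sr_mul_r]; congr 1; ring)⟩
          · exact ⟨l - k, .inl (by simp only [DihedralGroup.sr_mul_sr]; congr 1; ring)⟩
        inv_mem' := by
          rintro _ ⟨k, rfl | rfl⟩
          · exact ⟨-k, .inl (by simp)⟩
          · exact ⟨k, .inr (by simp)⟩ }
    have hH : Subgroup.closure
        {DihedralGroup.sr i, DihedralGroup.r (1 : ZMod (2 ^ n)) ^ 2 ^ (j + 1)} ≤ H := by
      rw [Subgroup.closure_le]
      rintro g (rfl | rfl)
      · exact ⟨0, .inr (by simp)⟩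
      · exact ⟨1, .inl (by simp)⟩
    obtain ⟨k, hk | hk⟩ := hH hmem
    · simp only [DihedralGroup.r_pow, one_mul, DihedralGroup.r.injEq] at hk
      -- This factor turns `2^j = 2^(j+1) k` into `2^(n-1) = 0` modulo `2^n`.
      have h1 := congrArg (2 ^ (n - 1 - j) * ·) hk
      push_cast at h1
      rw [← mul_assoc, ← pow_add, ← pow_add, show n - 1 - j + (j + 1) = n by omega,
        show n - 1 - j + j = n - 1 by omega] at h1
      have h2 : (2 ^ n : ZMod (2 ^ n)) = 0 := by exact_mod_cast ZMod.natCast_self (2 ^ n)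
      rw [h2, zero_mul] at h1
      have h3 : ((2 ^ (n - 1) : ℕ) : ZMod (2 ^ n)) = 0 := by exact_mod_cast h1
      rw [ZMod.natCast_eq_zero_iff, Nat.pow_dvd_pow_iff_le_right (by norm_num)] at h3
      omega
    · simp at hk
  notMem := by
    rw [← Subgroup.zpowers_eq_closure, Subgroup.mem_zpowers_iff]
    simp

theorem IsDihedralPair.map {G H : Type*} [Group G] [Group H] (e : G ≃* H) {n : ℕ} {r s : G}
    (h : IsDihedralPair n r s) : IsDihedralPair n (e r) (e s) where
  pow_eq_one := by rw [← map_pow, h.pow_eq_one, map_one]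
  mul_self := by rw [← map_mul, h.mul_self, map_one]
  mul_eq := by rw [← map_inv, ← map_mul, ← map_mul, h.mul_eq]
  closure_eq_top := by
    have := e.toMonoidHom.map_closure {s, r}
    rw [h.closure_eq_top, Subgroup.map_top_of_surjective _ e.surjective, Set.image_pair] at this
    exact this.symm
  pow_notMem j hj := by
    have := e.toMonoidHom.map_closure {s, r ^ 2 ^ (j + 1)}
    rw [Set.image_pair, MulEquiv.coe_toMonoidHom, map_pow] at this
    rw [← this, ← map_pow]
    rintro ⟨x, hx, hxe⟩
    obtain rfl := e.injective hxe
    exact h.pow_notMem j hj hx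
  notMem := by
    have := e.toMonoidHom.map_closure {r}
    rw [Set.image_singleton, MulEquiv.coe_toMonoidHom] at this
    rw [← this]
    rintro ⟨x, hx, hxe⟩
    obtain rfl := e.injective hxe
    exact h.notMem hx

/-! ### Fixed fields of subgroups given by generators -/

namespace IntermediateField

variable {K L : Type*} [Field K] [Field L] [Algebra K L]

theorem mem_fixedField_closure {S : Set (L ≃ₐ[K] L)} {x : L} :
    x ∈ fixedField (Subgroup.closure S) ↔ ∀ g ∈ S, g x = x := by
  rw [mem_fixedField_iff]
  refine ⟨fun h g hg ↦ h g (Subgroup.subset_closure hg), fun h g hg ↦ ?_⟩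
  have : Subgroup.closure S ≤ MulAction.stabilizer (L ≃ₐ[K] L) x := by
    rw [Subgroup.closure_le]
    exact fun g hg ↦ h g hg
  exact this hg

theorem exists_mem_fixedField_ne [FiniteDimensional K L] {H : Subgroup (L ≃ₐ[K] L)}
    {g : L ≃ₐ[K] L} (hg : g ∉ H) : ∃ x ∈ fixedField H, g x ≠ x := by
  by_contra! h
  apply hg
  rw [← fixingSubgroup_fixedField H, mem_fixingSubgroup_iff]
  exact h

end IntermediateField

/-! ### The tower of fixed fields in a dihedral extension -/

section Fields

open IntermediateField (fixedField mem_fixedField_closure exists_mem_fixedField_ne)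

variable {K L : Type*} [Field K] [Field L] [Algebra K L] {n : ℕ} {r s : L ≃ₐ[K] L}

theorem IsQuadraticStep.mk_of_fixedField [FiniteDimensional K L] {F E : IntermediateField K L}
    {H : Subgroup (L ≃ₐ[K] L)} {σ : L ≃ₐ[K] L} (hE : E = fixedField H)
    (hle : F ≤ E) (map_mem : ∀ x ∈ E, σ x ∈ E)
    (apply_apply : ∀ x ∈ E, σ (σ x) = x) (apply_eq_iff : ∀ x ∈ E, σ x = x ↔ x ∈ F) (hσ : σ ∉ H) :
    ∃ δ, IsQuadraticStep F E σ δ := by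
  subst hE
  obtain ⟨x, hx, hσx⟩ := exists_mem_fixedField_ne hσ
  exact ⟨x - σ x, hle, map_mem, apply_apply, apply_eq_iff, sub_mem hx (map_mem x hx),
    sub_ne_zero.2 hσx.symm, by rw [map_sub, apply_apply x hx, neg_sub]⟩

/-- The fixed field of the subgroup generated by `s` and `r ^ 2 ^ j`. -/
noncomputable def dihedralFixedField (r s : L ≃ₐ[K] L) (j : ℕ) : IntermediateField K L :=
  fixedField (Subgroup.closure {s, r ^ 2 ^ j})

theorem mem_dihedralFixedField {j : ℕ} {x : L} :
    x ∈ dihedralFixedField r s j ↔ s x = x ∧ (r ^ 2 ^ j) x = x := by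
  rw [dihedralFixedField, mem_fixedField_closure]
  simp only [Set.mem_insert_iff, Set.mem_singleton_iff, forall_eq_or_imp, forall_eq]

theorem IsDihedralPair.mem_bot [FiniteDimensional K L] [IsGalois K L] (h : IsDihedralPair n r s)
    {x : L} (hs : s x = x) (hr : r x = x) : x ∈ (⊥ : IntermediateField K L) := by
  have : fixedField (Subgroup.closure {s, r}) = (⊥ : IntermediateField K L) := by
    rw [h.closure_eq_top, InfiniteGalois.fixedField_bot]
  rw [← this, mem_fixedField_closure]
  simp [hs, hr]

theorem apply_of_mem_bot (σ : L ≃ₐ[K] L) {x : L} (hx : x ∈ (⊥ : IntermediateField K L)) :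
    σ x = x := by
  obtain ⟨y, rfl⟩ := IntermediateField.mem_bot.1 hx
  exact σ.commutes y

theorem IsDihedralPair.s_apply_s (h : IsDihedralPair n r s) (x : L) : s (s x) = x := by
  rw [← AlgEquiv.mul_apply, h.mul_self, AlgEquiv.one_apply]

theorem IsDihedralPair.mul_pow_eq (h : IsDihedralPair n r s) (m : ℕ) :
    s * r ^ m = (r ^ m)⁻¹ * s := by
  have h1 : SemiconjBy s r r⁻¹ := h.mul_eq
  have := h1.pow_right m
  rw [inv_pow] at this
  exact this

theorem IsDihedralPair.exists_step_bot [FiniteDimensional K L] [IsGalois K L]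
    (h : IsDihedralPair n r s) :
    ∃ δ, IsQuadraticStep ⊥ (fixedField (Subgroup.closure {r})) s δ := by
  have hmem : ∀ x, x ∈ fixedField (Subgroup.closure {r}) ↔ r x = x := by
    intro x
    rw [mem_fixedField_closure]
    simp
  have hr' : ∀ x, r x = x → r⁻¹ x = x := fun x hx ↦ by
    rw [AlgEquiv.aut_inv, AlgEquiv.symm_apply_eq, hx]
  refine IsQuadraticStep.mk_of_fixedField rfl bot_le ?_ (fun x _ ↦ h.s_apply_s x) ?_ h.notMem
  · intro x hx
    rw [hmem] at hx ⊢
    have h1 : r * s = s * r⁻¹ := by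
      rw [eq_mul_inv_iff_mul_eq, mul_assoc, h.mul_eq, mul_inv_cancel_left]
    rw [← AlgEquiv.mul_apply, h1, AlgEquiv.mul_apply, hr' x hx]
  · intro x hx
    exact ⟨fun hs ↦ h.mem_bot hs ((hmem x).1 hx), fun hx ↦ apply_of_mem_bot s hx⟩

/-- On elements fixed by `r^(2^(j+1))`, the rotation `r^(2^j)` is its own inverse, so `s r^(2^j) =
r^(-2^j) s` shows that it preserves the upper field. -/
theorem IsDihedralPair.exists_step [FiniteDimensional K L] (h : IsDihedralPair n r s) {j : ℕ}
    (hj : j < n) : ∃ δ, IsQuadraticStep (dihedralFixedField r s j)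
      (dihedralFixedField r s (j + 1)) (r ^ 2 ^ j) δ := by
  have hsq : r ^ 2 ^ (j + 1) = r ^ 2 ^ j * r ^ 2 ^ j := by
    rw [← pow_add]; congr 1; ring
  have hinv : ∀ x ∈ dihedralFixedField r s (j + 1), (r ^ 2 ^ j) ((r ^ 2 ^ j) x) = x := by
    intro x hx
    rw [← AlgEquiv.mul_apply, ← hsq]
    exact (mem_dihedralFixedField.1 hx).2
  refine IsQuadraticStep.mk_of_fixedField rfl ?_ ?_ hinv ?_ (h.pow_notMem j hj)
  · intro x hx
    rw [mem_dihedralFixedField] at hx ⊢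
    exact ⟨hx.1, by rw [hsq, AlgEquiv.mul_apply, hx.2, hx.2]⟩
  · intro x hx
    rw [mem_dihedralFixedField]
    constructor
    · rw [← AlgEquiv.mul_apply, h.mul_pow_eq, AlgEquiv.mul_apply, (mem_dihedralFixedField.1 hx).1,
        AlgEquiv.aut_inv, AlgEquiv.symm_apply_eq, hinv x hx]
    · rw [← AlgEquiv.mul_apply, ← pow_add, add_comm, pow_add, AlgEquiv.mul_apply,
        (mem_dihedralFixedField.1 hx).2]
  · intro x hx
    rw [mem_dihedralFixedField]
    exact ⟨fun hr ↦ ⟨(mem_dihedralFixedField.1 hx).1, hr⟩, fun h ↦ h.2⟩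

theorem IsDihedralPair.dihedralFixedField_zero [FiniteDimensional K L] [IsGalois K L]
    (h : IsDihedralPair n r s) : dihedralFixedField r s 0 = ⊥ := by
  refine le_antisymm (fun x hx ↦ ?_) bot_le
  rw [mem_dihedralFixedField, pow_zero, pow_one] at hx
  exact h.mem_bot hx.1 hx.2

variable {u π : K}

theorem IsTameSquareClassPair.bot (h : IsTameSquareClassPair K u π) :
    IsTameSquareClassPairIn (⊥ : IntermediateField K L) (algebraMap K L u)
      (algebraMap K L π) := by
  have hinj := (algebraMap K L).injective
  refine ⟨?_, algebraMap_mem _ _, algebraMap_mem _ _, ?_, ?_, ?_, ?_, ?_, ?_⟩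
  · rw [← map_ofNat (algebraMap K L)]
    simpa using h.two_ne_zero
  · simpa using h.left_ne_zero
  · simpa using h.right_ne_zero
  · intro x hx hx0
    obtain ⟨x, rfl⟩ := IntermediateField.mem_bot.1 hx
    obtain ⟨c, hc⟩ := h.exists_sq_class x (by simpa using hx0)
    refine ⟨algebraMap K L c, algebraMap_mem _ _, ?_⟩
    simp only [← map_pow, ← map_mul, hinj.eq_iff]
    exact hc
  · intro x hx y hy
    obtain ⟨x, rfl⟩ := IntermediateField.mem_bot.1 hx
    obtain ⟨y, rfl⟩ := IntermediateField.mem_bot.1 hy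
    simp only [← map_pow, ← map_mul, ← map_sub, hinj.ne_iff]
    exact h.norm_ne x y
  · obtain ⟨x, y, hxy⟩ := h.neg_one_norm
    refine ⟨_, algebraMap_mem _ x, _, algebraMap_mem _ y, ?_⟩
    simp only [← map_pow, ← map_mul, ← map_sub, hxy, map_neg, map_one]
  · refine h.left_eq.imp (fun h ↦ by simp [h]) fun ⟨w, hw⟩ ↦
      ⟨_, algebraMap_mem _ w, ?_⟩
    rw [← map_pow, hw, map_neg, map_one]

/-- The square root of `u` is not moved by `r` alone. -/
theorem IsDihedralPair.sq_ne_of_apply [FiniteDimensional K L] [IsGalois K L]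
    (h : IsDihedralPair n r s) (hn : 2 ≤ n) (hK : IsTameSquareClassPair K u π) {δ : L}
    (hs : s δ = δ) (hr : r δ = -δ) : δ ^ 2 ≠ algebraMap K L u := by
  intro hδ
  have hbot : IsTameSquareClassPairIn (⊥ : IntermediateField K L) (algebraMap K L u)
      (algebraMap K L π) := hK.bot
  have hδ0 : δ ≠ 0 := by
    rintro rfl
    exact hbot.left_ne_zero (by simp [← hδ])
  obtain ⟨δ₀, h₀⟩ := h.exists_step (j := 0) (by omega)
  rw [h.dihedralFixedField_zero] at h₀
  simp only [pow_zero, pow_one, zero_add] at h₀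
  have h₁ : IsQuadraticStep ⊥ (dihedralFixedField r s 1) r δ :=
    ⟨h₀.le, h₀.map_mem, h₀.apply_apply, h₀.apply_eq_iff, by
      rw [mem_dihedralFixedField, pow_one, pow_two]
      simp [hs, hr], hδ0, hr⟩
  -- If `δ² = u`, the norm of `ε²` is a square `c²` in `K(δ)`, so `ε·r(ε) = ±c` is fixed by `s`. But
  -- `s` sends it to `ε·r⁻¹(ε)`, whence `r²(ε) = ε`, against `r²(ε) = -ε`.
  obtain ⟨ε, hε⟩ := h.exists_step (j := 1) (by omega)
  have hε0 := hε.ne_zero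
  obtain ⟨c, hc, hc0, hεc⟩ := h₁.exists_mul_conj_eq_sq hδ hbot hε.sq_mem (pow_ne_zero 2 hε0)
  have hsc : s c = c := (mem_dihedralFixedField.1 hc).1
  have hsε : s ε = ε := (mem_dihedralFixedField.1 hε.mem).1
  have hst : s (ε * r ε) = ε * r ε := by
    rw [map_pow, ← mul_pow, sq_eq_sq_iff_eq_or_eq_neg] at hεc
    rcases hεc with hεc | hεc <;> rw [hεc]
    · exact hsc
    · rw [map_neg, hsc]
  rw [map_mul, hsε, mul_right_inj' hε0, ← AlgEquiv.mul_apply, h.mul_eq, AlgEquiv.mul_apply, hsε,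
    AlgEquiv.aut_inv, AlgEquiv.symm_apply_eq] at hst
  have hneg := hε.apply_eq_neg
  rw [pow_one, pow_two, AlgEquiv.mul_apply, ← hst] at hneg
  exact mul_ne_zero hbot.two_ne_zero hε0 (by linear_combination hneg)

/-- In a dihedral extension of degree at least `8`, the fixed field of the rotations is generated
by a square root of `u`. -/
theorem IsDihedralPair.exists_sq_eq [FiniteDimensional K L] [IsGalois K L]
    (h : IsDihedralPair n r s) (h' : IsDihedralPair n r (s * r)) (hn : 2 ≤ n)
    (hK : IsTameSquareClassPair K u π) :
    ∃ a : L, a ^ 2 = algebraMap K L u ∧ r a = a ∧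
      IsQuadraticStep ⊥ (fixedField (Subgroup.closure {r})) s a := by
  have hbot : IsTameSquareClassPairIn (⊥ : IntermediateField K L) (algebraMap K L u)
      (algebraMap K L π) := hK.bot
  have h2 := hbot.two_ne_zero
  have hu0 := hbot.left_ne_zero
  have hπ0 := hbot.right_ne_zero
  obtain ⟨δ₁, h₁⟩ := h.exists_step (j := 0) (by omega)
  rw [h.dihedralFixedField_zero] at h₁
  simp only [pow_zero, pow_one, zero_add] at h₁
  obtain ⟨δ₀, h₀⟩ := h.exists_step_bot
  have hr₀ : r δ₀ = δ₀ := mem_fixedField_closure.1 h₀.mem r rfl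
  have hs₁ : s δ₁ = δ₁ := (mem_dihedralFixedField.1 h₁.mem).1
  have hs₀ := h₀.apply_eq_neg
  have hr₁ := h₁.apply_eq_neg
  have hd₀ := h₀.ne_zero
  have hd₁ := h₁.ne_zero
  -- an element moved by some automorphism has nonsquare square
  have hnsq : ∀ (σ : L ≃ₐ[K] L) (δ c : L), δ ≠ 0 → σ δ = -δ →
      c ∈ (⊥ : IntermediateField K L) → δ ^ 2 ≠ c ^ 2 := by
    intro σ δ c hδ hσ hc hδc
    have : σ δ = δ := by
      rcases sq_eq_sq_iff_eq_or_eq_neg.1 hδc with rfl | rfl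
      · exact apply_of_mem_bot σ hc
      · rw [map_neg, apply_of_mem_bot σ hc]
    rw [hσ] at this
    exact mul_ne_zero h2 hδ (by linear_combination -this)
  have hu₁ : ∀ c ∈ (⊥ : IntermediateField K L), δ₁ ^ 2 ≠ algebraMap K L u * c ^ 2 := by
    intro c hc hδ
    have hc0 : c ≠ 0 := by rintro rfl; simp [hd₁] at hδ
    refine h.sq_ne_of_apply hn hK (δ := δ₁ / c) ?_ ?_ (by rw [div_pow, hδ]; field_simp)
    · rw [map_div₀, hs₁, apply_of_mem_bot s hc]
    · rw [map_div₀, hr₁, apply_of_mem_bot r hc, neg_div]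
  have hu₂ : ∀ c ∈ (⊥ : IntermediateField K L),
      (δ₀ * δ₁) ^ 2 ≠ algebraMap K L u * c ^ 2 := by
    intro c hc hδ
    have hc0 : c ≠ 0 := by rintro rfl; simp [hd₁, hd₀] at hδ
    -- The reflection `s * r` fixes `δ₀δ₁`, because `s` negates `δ₀` only and `r` negates `δ₁` only.
    refine h'.sq_ne_of_apply hn hK (δ := δ₀ * δ₁ / c) ?_ ?_ (by rw [div_pow, hδ]; field_simp)
    · rw [AlgEquiv.mul_apply]
      simp only [map_div₀, map_mul, hr₀, hr₁, hs₀, hs₁, map_neg, apply_of_mem_bot s hc,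
        apply_of_mem_bot r hc]
      ring
    · simp only [map_div₀, map_mul, hr₀, hr₁, apply_of_mem_bot r hc]
      ring
  have hn₂ : ∀ c ∈ (⊥ : IntermediateField K L), (δ₀ * δ₁) ^ 2 ≠ c ^ 2 := fun c hc ↦
    hnsq s _ c (mul_ne_zero hd₀ hd₁) (by rw [map_mul, hs₀, hs₁, neg_mul]) hc
  have hbu : algebraMap K L u ∈ (⊥ : IntermediateField K L) := algebraMap_mem _ _
  have hbπ : algebraMap K L π ∈ (⊥ : IntermediateField K L) := algebraMap_mem _ _
  obtain ⟨c₀, hc₀, H₀⟩ := hbot.exists_sq_class _ h₀.sq_mem (pow_ne_zero 2 hd₀)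
  obtain ⟨c₁, hc₁, H₁⟩ := hbot.exists_sq_class _ h₁.sq_mem (pow_ne_zero 2 hd₁)
  -- The class of `δ₁²` is `π` or `uπ`. Were that of `δ₀²` also one of these, the class of `(δ₀δ₁)²`
  -- would be `1` or `u`, and both are excluded.
  have key : δ₀ ^ 2 = algebraMap K L u * c₀ ^ 2 := by
    have H₀' := H₀.resolve_left (hnsq s δ₀ c₀ hd₀ hs₀ hc₀)
    have H₁' := (H₁.resolve_left (hnsq r δ₁ c₁ hd₁ hr₁ hc₁)).resolve_left (hu₁ c₁ hc₁)
    have hm := mul_mem hbπ (mul_mem hc₀ hc₁)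
    rcases H₀' with H₀' | H₀' | H₀'
    · exact H₀'
    · rcases H₁' with H₁' | H₁'
      · exact (hn₂ _ hm (by rw [mul_pow, H₀', H₁']; ring)).elim
      · exact (hu₂ _ hm (by rw [mul_pow, H₀', H₁']; ring)).elim
    · rcases H₁' with H₁' | H₁'
      · exact (hu₂ _ hm (by rw [mul_pow, H₀', H₁']; ring)).elim
      · exact (hn₂ _ (mul_mem hbu hm) (by rw [mul_pow, H₀', H₁']; ring)).elim
  have hc0 : c₀ ≠ 0 := by rintro rfl; simp [hd₀] at key
  refine ⟨δ₀ / c₀, by rw [div_pow, key]; field_simp, ?_,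
    ⟨h₀.le, h₀.map_mem, h₀.apply_apply, h₀.apply_eq_iff, div_mem h₀.mem (h₀.le hc₀),
      div_ne_zero hd₀ hc0, ?_⟩⟩
  · rw [map_div₀, hr₀, apply_of_mem_bot r hc₀]
  · rw [map_div₀, hs₀, apply_of_mem_bot s hc₀, neg_div]

/-- Every step of the tower is ramified: its generator is not a square root of `u` times a square,
since `s` fixes the tower but negates `a = √u`. So its square is `ρ` or `uρ` up to squares, and the
latter case changes the exponent `k`. -/
theorem IsDihedralPair.exists_pow_eq_mul [FiniteDimensional K L] [IsGalois K L]
    (h : IsDihedralPair n r s) (hK : IsTameSquareClassPair K u π) {a : L}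
    (ha : a ^ 2 = algebraMap K L u) (hsa : s a = -a) (j : ℕ) (hj : j ≤ n) :
    ∃ (ρ : L) (k : ℕ), IsTameSquareClassPairIn (dihedralFixedField r s j) (algebraMap K L u) ρ ∧
      ρ ^ 2 ^ j = algebraMap K L (u ^ k * π) := by
  have hbot : IsTameSquareClassPairIn (⊥ : IntermediateField K L) (algebraMap K L u)
      (algebraMap K L π) := hK.bot
  have h2 := hbot.two_ne_zero
  induction j with
  | zero =>
    refine ⟨algebraMap K L π, 0, ?_, by simp⟩
    rwa [h.dihedralFixedField_zero]
  | succ j ih =>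
    obtain ⟨ρ, k, hρ, hρk⟩ := ih (by omega)
    obtain ⟨δ, hδ⟩ := h.exists_step (j := j) (by omega)
    have hδ0 := hδ.ne_zero
    obtain ⟨c, hc, H⟩ := hρ.exists_sq_class _ hδ.sq_mem (pow_ne_zero 2 hδ0)
    have hc0 : c ≠ 0 := by
      rintro rfl
      simp [hδ0] at H
    have hδc : IsQuadraticStep (dihedralFixedField r s j) (dihedralFixedField r s (j + 1))
        (r ^ 2 ^ j) (δ / c) :=
      ⟨hδ.le, hδ.map_mem, hδ.apply_apply, hδ.apply_eq_iff, div_mem hδ.mem (hδ.le hc),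
        div_ne_zero hδ0 hc0, by rw [map_div₀, hδ.apply_eq_neg, hδ.apply_of_mem hc, neg_div]⟩
    have hs : s (δ / c) = δ / c := (mem_dihedralFixedField.1 hδc.mem).1
    rcases H with H | H | H | H
    · exfalso
      have h1 : (δ / c) ^ 2 = 1 := by rw [div_pow, H]; field_simp
      have h3 := hδc.apply_eq_neg
      have h4 : (r ^ 2 ^ j) (δ / c) = δ / c := by
        rcases sq_eq_sq_iff_eq_or_eq_neg.1 (h1.trans (one_pow 2).symm) with h | h <;>
            rw [h] <;> simp
      rw [h4] at h3
      exact mul_ne_zero h2 hδc.ne_zero (by linear_combination h3)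
    · exfalso
      have h1 : (δ / c) ^ 2 = a ^ 2 := by rw [div_pow, H, ha]; field_simp
      have h3 : s (δ / c) = -(δ / c) := by
        rcases sq_eq_sq_iff_eq_or_eq_neg.1 h1 with h | h <;> rw [h] <;> simp [hsa]
      rw [hs] at h3
      exact mul_ne_zero h2 hδc.ne_zero (by linear_combination h3)
    · have h1 : (δ / c) ^ 2 = ρ := by rw [div_pow, H]; field_simp
      refine ⟨δ / c, k, hδc.isTameSquareClassPairIn (by rwa [h1]), ?_⟩
      rw [pow_succ' 2 j, pow_mul, h1, hρk]
    · have h1 : (δ / c) ^ 2 = algebraMap K L u * ρ := by rw [div_pow, H]; field_simp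
      refine ⟨δ / c, 2 ^ j + k, hδc.isTameSquareClassPairIn (by rw [h1]; exact hρ.mul_right), ?_⟩
      rw [pow_succ' 2 j, pow_mul, h1, mul_pow, hρk, ← map_pow, ← map_mul]
      congr 1
      ring

end Fields

/-! ### Roots of unity and radicals in a dihedral extension -/

section Structure

open IntermediateField (fixedField mem_fixedField_closure)

variable {K L : Type*} [Field K] [Field L] [Algebra K L] {n : ℕ} {r s : L ≃ₐ[K] L} {u π : K}

theorem isPrimitiveRoot_two_pow_of_pow_eq_neg_one {R : Type*} [CommRing R] [IsDomain R]
    (h2 : (2 : R) ≠ 0) {ζ : R} {m : ℕ} (h : ζ ^ 2 ^ m = -1) :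
    IsPrimitiveRoot ζ (2 ^ (m + 1)) := by
  rw [IsPrimitiveRoot.iff_orderOf]
  refine orderOf_eq_prime_pow ?_ ?_
  · rw [h]
    intro h1
    exact h2 (by linear_combination -h1)
  · rw [pow_succ, pow_mul, h, neg_one_sq]

/-- The factor `t u^k` lies in the class of `1` or `u`, so the right side lies in the class of `π`
or `uπ`, neither of which contains norms from `K(√u)`. -/
theorem IsTameSquareClassPair.pow_mul_ne (hK : IsTameSquareClassPair K u π)
    {E : IntermediateField K L} {a : L} (h : IsQuadraticStep ⊥ E s a)
    (ha : a ^ 2 = algebraMap K L u) {x : L} (hx : x ∈ E) {t : K} {m : ℕ} (ht : t ^ 2 ^ m = 1)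
    (k : ℕ) : x * s x ≠ algebraMap K L (t * (u ^ k * π)) := by
  intro hxt
  have hbot : IsTameSquareClassPairIn (⊥ : IntermediateField K L) (algebraMap K L u)
      (algebraMap K L π) := hK.bot
  have hu0 := hK.left_ne_zero
  have hclass : ∀ k : ℕ, ∃ c : K, c ≠ 0 ∧ (t * u ^ k = c ^ 2 ∨ t * u ^ k = u * c ^ 2) := by
    have ht0 : t ≠ 0 := by rintro rfl; simp at ht
    intro k
    induction k with
    | zero =>
      obtain ⟨c, hc⟩ := hK.sq_class_of_pow_eq_one m t ht
      refine ⟨c, ?_, by simpa using hc⟩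
      rintro rfl
      simp [ht0] at hc
    | succ k ih =>
      obtain ⟨c, hc0, hc | hc⟩ := ih
      · exact ⟨c, hc0, .inr (by rw [pow_succ]; linear_combination u * hc)⟩
      · exact ⟨u * c, mul_ne_zero hu0 hc0, .inl (by rw [pow_succ]; linear_combination u * hc)⟩
  obtain ⟨c, hc0, hc⟩ := hclass k
  have hcm : algebraMap K L c ∈ (⊥ : IntermediateField K L) :=
    IntermediateField.algebraMap_mem _ _
  have hcm0 : algebraMap K L c ≠ 0 := by simpa using hc0
  rw [← mul_assoc] at hxt
  rcases hc with hc | hc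
  · refine h.mul_conj_ne_mul_right ha hbot hx hcm hcm0 ?_
    rw [hxt, hc]
    simp only [map_mul, map_pow]
    ring
  · refine h.mul_conj_ne_mul_right ha hbot.mul_right hx hcm hcm0 ?_
    rw [hxt, hc]
    simp only [map_mul, map_pow]
    ring

theorem IsTameSquareClassPair.apply_eq_of_pow_eq_one (hK : IsTameSquareClassPair K u π) {a y : L}
    (hE : IsQuadraticStep ⊥ (fixedField (Subgroup.closure {r})) s a)
    (ha : a ^ 2 = algebraMap K L u) {k : ℕ} (hsy : s y = y)
    (hy : y ^ 2 = algebraMap K L (u ^ k * π)) (m : ℕ) (w : L) (hw : w ^ 2 ^ m = 1) :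
    r w = w := by
  have hmem : ∀ x, x ∈ fixedField (Subgroup.closure {r}) ↔ r x = x := by
    intro x
    rw [mem_fixedField_closure]
    simp
  induction m generalizing w with
  | zero =>
    rw [pow_zero, pow_one] at hw
    rw [hw, map_one]
  | succ m ih =>
    have h1 : r w ^ 2 = w ^ 2 := by
      rw [← map_pow]
      exact ih (w ^ 2) (by rw [← pow_mul, ← pow_succ', hw])
    rcases sq_eq_sq_iff_eq_or_eq_neg.1 h1 with hrw | hrw
    · exact hrw
    exfalso
    have h2 : r y ^ 2 = y ^ 2 := by rw [← map_pow, hy, AlgEquiv.commutes]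
    rcases sq_eq_sq_iff_eq_or_eq_neg.1 h2 with hry | hry
    · refine hK.pow_mul_ne hE ha ((hmem y).2 hry) (t := 1) (m := 0) (one_pow _) k ?_
      rw [hsy, ← sq, hy, one_mul]
    -- When `r` negates both `w` and `y`, their product lies in `K(√u)` and has norm `w s(w) u^k π`,
    -- where `w s(w)` is a root of unity in `K`.
    · have hwy : w * y ∈ fixedField (Subgroup.closure {r}) := by
        rw [hmem, map_mul, hrw, hry, neg_mul_neg]
      have hy0 : y ^ 2 ≠ 0 := by
        rw [hy, map_ne_zero]
        exact mul_ne_zero (pow_ne_zero k hK.left_ne_zero) hK.right_ne_zero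
      have hN := hE.mul_conj_mem hwy
      have hN' : w * y * s (w * y) = w * s w * y ^ 2 := by rw [map_mul, hsy]; ring
      have ht : w * s w ∈ (⊥ : IntermediateField K L) := by
        have : w * s w = w * y * s (w * y) / y ^ 2 := by
          rw [hN', mul_div_assoc, div_self hy0, mul_one]
        rw [this]
        exact div_mem hN (by rw [hy]; exact IntermediateField.algebraMap_mem _ _)
      obtain ⟨t, ht⟩ := IntermediateField.mem_bot.1 ht
      have ht1 : t ^ 2 ^ (m + 1) = 1 := by
        apply (algebraMap K L).injective
        rw [map_pow, ht, mul_pow, ← map_pow, hw, map_one, map_one, one_mul]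
      refine hK.pow_mul_ne hE ha hwy ht1 k ?_
      rw [hN', hy, ← ht, ← map_mul]

/-- The structure of dihedral extensions of 2-power degree at least `8`. -/
theorem IsTameSquareClassPair.exists_generators_of_mulEquiv_dihedralGroup [FiniteDimensional K L]
    [IsGalois K L] (hK : IsTameSquareClassPair K u π) (hn : 2 ≤ n)
    (e : (L ≃ₐ[K] L) ≃* DihedralGroup (2 ^ n)) :
    (∀ x : K, x ^ 2 ≠ -1) ∧ ∃ i η ρ : L, i ^ 2 = -1 ∧ IsPrimitiveRoot η (2 ^ (n + 1)) ∧
      η ∈ K⟮i⟯ ∧ ρ ^ 2 ^ n = algebraMap K L π := by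
  obtain ⟨r, s, h, h'⟩ : ∃ r s : L ≃ₐ[K] L, IsDihedralPair n r s ∧ IsDihedralPair n r (s * r) := by
    refine ⟨e.symm (.r 1), e.symm (.sr 0), (DihedralGroup.isDihedralPair n 0).map e.symm, ?_⟩
    have := (DihedralGroup.isDihedralPair n 1).map e.symm
    rwa [← map_mul, DihedralGroup.sr_mul_r, zero_add]
  have hbot : IsTameSquareClassPairIn (⊥ : IntermediateField K L) (algebraMap K L u)
      (algebraMap K L π) := hK.bot
  have h2 := hbot.two_ne_zero
  have hmem : ∀ x, x ∈ fixedField (Subgroup.closure {r}) ↔ r x = x := by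
    intro x
    rw [mem_fixedField_closure]
    simp
  obtain ⟨a, ha, hra, hE⟩ := h.exists_sq_eq h' hn hK
  obtain ⟨ρ, k, hρ, hρk⟩ := h.exists_pow_eq_mul hK ha hE.apply_eq_neg n le_rfl
  have hsρ : s ρ = ρ := (mem_dihedralFixedField.1 hρ.right_mem).1
  have hρ0 : ρ ≠ 0 := hρ.right_ne_zero
  have hpow : 2 ^ n = 2 ^ (n - 1) * 2 := by
    rw [← pow_succ, Nat.sub_add_cancel (by omega)]
  have hy : (ρ ^ 2 ^ (n - 1)) ^ 2 = algebraMap K L (u ^ k * π) := by rw [← pow_mul, ← hpow, hρk]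
  have hsy : s (ρ ^ 2 ^ (n - 1)) = ρ ^ 2 ^ (n - 1) := by rw [map_pow, hsρ]
  obtain ⟨ζ, hζ⟩ : ∃ ζ, r ρ = ζ * ρ := ⟨r ρ / ρ, by field_simp⟩
  have hζ1 : ζ ^ 2 ^ n = 1 := by
    have h1 : r ρ ^ 2 ^ n = ρ ^ 2 ^ n := by rw [← map_pow, hρk, AlgEquiv.commutes]
    rw [hζ, mul_pow] at h1
    exact (mul_eq_right₀ (pow_ne_zero _ hρ0)).1 h1
  have hrζ : r ζ = ζ := hK.apply_eq_of_pow_eq_one hE ha hsy hy n ζ hζ1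
  have hζneg : ζ ^ 2 ^ (n - 1) = -1 := by
    have h1 : (ζ ^ 2 ^ (n - 1)) ^ 2 = 1 ^ 2 := by rw [← pow_mul, ← hpow, hζ1, one_pow]
    -- Otherwise `ρ^(2^(n-1))` would be fixed by `r`, hence lie in `K(√u)`, and its norm would be
    -- its square `u^k π`.
    refine (sq_eq_sq_iff_eq_or_eq_neg.1 h1).resolve_left fun h3 ↦ ?_
    refine hK.pow_mul_ne hE ha (x := ρ ^ 2 ^ (n - 1)) ?_ (t := 1) (m := 0) (one_pow _) k ?_
    · rw [hmem, map_pow, hζ, mul_pow, h3, one_mul]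
    · rw [hsy, ← sq, hy, one_mul]
  have hζ0 : ζ ≠ 0 := by
    rintro rfl
    simp at hζ1
  have hsζ : ζ * s ζ = 1 := by
    have h1 : r⁻¹ ρ = ζ⁻¹ * ρ := by
      rw [AlgEquiv.aut_inv, AlgEquiv.symm_apply_eq, map_mul, map_inv₀, hrζ, hζ,
        inv_mul_cancel_left₀ hζ0]
    have h3 : s (r ρ) = r⁻¹ (s ρ) := by
      rw [← AlgEquiv.mul_apply, h.mul_eq, AlgEquiv.mul_apply]
    rw [hsρ, h1, hζ, map_mul, hsρ] at h3
    rw [mul_right_cancel₀ hρ0 h3, mul_inv_cancel₀ hζ0]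
  have hζE : ζ ∈ fixedField (Subgroup.closure {r}) := (hmem ζ).2 hrζ
  set i := ζ ^ 2 ^ (n - 2) with hi_def
  have hi : i ^ 2 = -1 := by
    rw [hi_def, ← pow_mul, ← pow_succ, show n - 2 + 1 = n - 1 by omega, hζneg]
  have hi0 : i ≠ 0 := by
    intro h0
    simp [h0] at hi
  have hri : r i = i := by rw [hi_def, map_pow, hrζ]
  have hsi : s i = -i := by
    have h1 : i * s i = 1 := by rw [hi_def, map_pow, ← mul_pow, hsζ, one_pow]
    apply mul_left_cancel₀ hi0
    linear_combination h1 + hi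
  have hneg : ∀ x : K, x ^ 2 ≠ -1 := by
    intro x hx
    have h1 : i ^ 2 = algebraMap K L x ^ 2 := by rw [← map_pow, hx, hi, map_neg, map_one]
    have h3 : s i = i := by
      rcases sq_eq_sq_iff_eq_or_eq_neg.1 h1 with h | h <;> rw [h] <;> simp
    rw [hsi] at h3
    exact mul_ne_zero h2 hi0 (by linear_combination -h3)
  -- Hilbert 90 for `ζ` of norm `1`; with `N(y) = c²` it gives `ζ = (y/c)²`.
  obtain ⟨y, hy, hy0, hζy⟩ := hE.exists_mul_apply_eq hζE (IntermediateField.one_mem _)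
    (by rw [hsζ, one_pow])
  obtain ⟨c, hc, hc0, hyc⟩ := hE.exists_mul_conj_eq_sq ha hbot hy hy0
  have hsy0 : s y ≠ 0 := by simpa using hy0
  have hη2 : (y / c) ^ 2 = ζ := by
    rw [div_pow, ← hyc]
    field_simp
    linear_combination -hζy
  have hηr : r (y / c) = y / c := by rw [map_div₀, (hmem y).1 hy, (hmem c).1 hc]
  have hηneg : (y / c) ^ 2 ^ n = -1 := by rw [hpow, mul_comm, pow_mul, hη2, hζneg]
  have hstep : IsQuadraticStep ⊥ (fixedField (Subgroup.closure {r})) s i :=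
    ⟨hE.le, hE.map_mem, hE.apply_apply, hE.apply_eq_iff, (hmem i).2 hri, hi0, hsi⟩
  have hu : u = -1 := hK.left_eq.resolve_right fun ⟨w, hw⟩ ↦ hneg w hw
  refine ⟨hneg, i, y / c, ρ * (y / c) ^ k, hi,
    isPrimitiveRoot_two_pow_of_pow_eq_neg_one h2 hηneg, ?_, ?_⟩
  · obtain ⟨A, hA, B, hB, hAB⟩ := hstep.exists_eq_add_mul h2 ((hmem _).2 hηr)
    rw [hAB]
    have hle : (⊥ : IntermediateField K L) ≤ K⟮i⟯ := bot_le
    exact add_mem (hle hA) (mul_mem (hle hB) (IntermediateField.mem_adjoin_simple_self K i))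
  -- The factor `(y/c)^k` contributes `(-1)^k`, which cancels `u^k` because `u = -1`.
  · rw [mul_pow, hρk, ← pow_mul, mul_comm k, pow_mul, hηneg, hu, map_mul, map_pow, map_neg, map_one,
      mul_right_comm, ← mul_pow]
    simp

end Structure

/-! ### The converse: Kummer extensions with dihedral group -/

theorem DihedralGroup.exists_monoidHom {G : Type*} [Group G] {m : ℕ} {t s : G} (ht : t ^ m = 1)
    (hs : s * s = 1) (hst : s * t = t⁻¹ * s) :
    ∃ φ : DihedralGroup m →* G, (∀ k : ℕ, φ (.r k) = t ^ k) ∧ ∀ k : ℕ, φ (.sr k) = s * t ^ k := by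
  obtain ⟨T, hT⟩ : ∃ T : ZMod m →+ Additive G, ∀ k : ℤ, (T k).toMul = t ^ k :=
    ⟨ZMod.lift m ⟨zmultiplesHom (Additive G) (Additive.ofMul t), by
      rw [zmultiplesHom_apply, ← ofMul_zpow, zpow_natCast, ht, ofMul_one]⟩, fun k ↦ by
      rw [ZMod.lift_coe]; simp⟩
  have hT' : ∀ k : ℕ, (T k).toMul = t ^ k := fun k ↦ by
    simpa using hT k
  have hsT : ∀ j, s * (T j).toMul * s = (T j).toMul⁻¹ := by
    intro j
    obtain ⟨k, rfl⟩ := ZMod.intCast_surjective j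
    have h : SemiconjBy s t t⁻¹ := hst
    have := (h.zpow_right k).eq
    rw [hT, this, inv_zpow, mul_assoc, hs, mul_one]
  have hTs : ∀ j, (T j).toMul * s = s * (T j).toMul⁻¹ := fun j ↦ by
    rw [← hsT, ← mul_assoc, ← mul_assoc, hs, one_mul]
  have hcomm : ∀ i j, (T i).toMul * (T j).toMul = (T j).toMul * (T i).toMul := fun i j ↦ by
    rw [← toMul_add, ← toMul_add, ← map_add, ← map_add, add_comm i j]
  refine ⟨MonoidHom.mk' (fun
    | .r j => (T j).toMul
    | .sr j => s * (T j).toMul) ?_, hT', fun k ↦ congrArg (s * ·) (hT' k)⟩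
  rintro (i | i) (j | j)
  · simp
  · simp only [DihedralGroup.r_mul_sr, map_sub, toMul_sub, div_eq_mul_inv]
    rw [← mul_assoc (T i).toMul, hTs, mul_assoc, ← toMul_neg, ← map_neg, hcomm]
  · simp [mul_assoc]
  · simp only [DihedralGroup.sr_mul_sr, map_sub, toMul_sub, div_eq_mul_inv]
    rw [← mul_assoc, hsT, ← toMul_neg, ← map_neg, hcomm]

section Converse

variable {K L : Type*} [Field K] [Field L] [Algebra K L] {n : ℕ} {u π : K}

open IntermediateField (adjoin fixedField mem_fixedField_closure)

theorem IntermediateField.apply_eq_apply_of_mem_adjoin {S : Set L} {σ τ : L ≃ₐ[K] L}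
    (h : ∀ x ∈ S, σ x = τ x) {x : L} (hx : x ∈ adjoin K S) : σ x = τ x := by
  have hle : adjoin K S ≤ fixedField (Subgroup.closure {τ⁻¹ * σ}) := by
    rw [adjoin_le_iff]
    intro y hy
    rw [SetLike.mem_coe, mem_fixedField_closure]
    rintro g rfl
    rw [AlgEquiv.mul_apply, AlgEquiv.aut_inv, AlgEquiv.symm_apply_eq, h y hy]
  have := mem_fixedField_closure.1 (hle hx) _ rfl
  rwa [AlgEquiv.mul_apply, AlgEquiv.aut_inv, AlgEquiv.symm_apply_eq] at this

theorem eq_one_or_eq_neg_one_of_pow_two_pow_eq_one (hneg : ∀ x : K, x ^ 2 ≠ -1) {t : K} {m : ℕ}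
    (ht : t ^ 2 ^ m = 1) : t = 1 ∨ t = -1 := by
  induction m generalizing t with
  | zero => left; simpa using ht
  | succ m ih =>
    have := ih (t := t ^ 2) (by rw [← pow_mul, ← pow_succ', ht])
    exact sq_eq_one_iff.1 (this.resolve_right (hneg t))

theorem isGalois_of_adjoin_pair_eq_top (h2 : (2 : K) ≠ 0) {a : K} (ha : a ≠ 0) (hn : 2 ≤ n)
    {i ρ ζ : L} (hi : i ^ 2 = -1) (hρ : ρ ^ 2 ^ n = algebraMap K L a)
    (hζ : IsPrimitiveRoot ζ (2 ^ n)) (htop : adjoin K {i, ρ} = ⊤) : IsGalois K L := by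
  have hpos : 0 < 2 ^ n := by positivity
  have hρ0 : ρ ≠ 0 := by
    rintro rfl
    rw [zero_pow hpos.ne'] at hρ
    exact ha ((map_eq_zero _).1 hρ.symm)
  have hsep : (Polynomial.X ^ 2 ^ n - Polynomial.C a : Polynomial K).Separable :=
    Polynomial.separable_X_pow_sub_C a (by push_cast; exact pow_ne_zero _ h2) ha
  have hroot : ∀ x : L, x ^ 2 ^ n = algebraMap K L a →
      x ∈ adjoin K ((Polynomial.X ^ 2 ^ n - Polynomial.C a : Polynomial K).rootSet L) := by
    intro x hx
    apply IntermediateField.subset_adjoin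
    rw [Polynomial.mem_rootSet_of_ne (Polynomial.X_pow_sub_C_ne_zero hpos a)]
    simp [hx]
  have : Polynomial.IsSplittingField K L (Polynomial.X ^ 2 ^ n - Polynomial.C a) := by
    rw [isSplittingField_iff_intermediateField]
    refine ⟨?_, ?_⟩
    · rw [Polynomial.map_sub, Polynomial.map_pow, Polynomial.map_X, Polynomial.map_C]
      exact X_pow_sub_C_splits_of_isPrimitiveRoot hζ hρ
    · rw [eq_top_iff, ← htop, IntermediateField.adjoin_le_iff]
      have hρm := hroot ρ hρ
      have hζm : ζ ∈ adjoin K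
          ((Polynomial.X ^ 2 ^ n - Polynomial.C a : Polynomial K).rootSet L) := by
        have h1 := hroot (ζ * ρ) (by rw [mul_pow, hζ.pow_eq_one, one_mul, hρ])
        have h3 := div_mem h1 hρm
        rwa [mul_div_cancel_right₀ ζ hρ0] at h3
      rintro x (rfl | rfl)
      · have h1 : IsPrimitiveRoot (ζ ^ 2 ^ (n - 1)) 2 := hζ.pow hpos (by
          rw [← pow_succ, Nat.sub_add_cancel (by omega)])
        -- Since `n ≥ 2`, a power of `ζ` is a square root of `-1`, so the splitting field already
        -- contains `i`.
        have h3 : (ζ ^ 2 ^ (n - 2)) ^ 2 = x ^ 2 := by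
          rw [hi, ← pow_mul, ← pow_succ, show n - 2 + 1 = n - 1 by omega,
            h1.eq_neg_one_of_two_right]
        rcases sq_eq_sq_iff_eq_or_eq_neg.1 h3 with h3 | h3
        · rw [← h3]
          exact pow_mem hζm _
        · rw [← neg_eq_iff_eq_neg.2 h3]
          exact neg_mem (pow_mem hζm _)
      · exact hρm
  exact IsGalois.of_separable_splitting_field hsep

theorem isQuadraticStep_adjoin_of_sq_eq_neg_one [FiniteDimensional K L] [IsGalois K L] {i : L}
    (hi0 : i ≠ 0) (hi : i ^ 2 = -1) {σ : L ≃ₐ[K] L} (hσ : σ i = -i) :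
    IsQuadraticStep ⊥ K⟮i⟯ σ i := by
  have hii : i ∈ K⟮i⟯ := IntermediateField.mem_adjoin_simple_self K i
  refine ⟨bot_le, ?_, ?_, ?_, hii, hi0, hσ⟩
  · intro x hx
    have hle : (K⟮i⟯).map σ.toAlgHom ≤ K⟮i⟯ := by
      rw [IntermediateField.adjoin_map, IntermediateField.adjoin_le_iff, Set.image_singleton,
        Set.singleton_subset_iff]
      change σ i ∈ K⟮i⟯
      rw [hσ]
      exact neg_mem hii
    exact hle ⟨x, hx, rfl⟩
  · intro x hx
    exact IntermediateField.apply_eq_apply_of_mem_adjoin (σ := σ * σ) (τ := 1)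
      (by rintro y rfl; simp [hσ]) hx
  · intro x hx
    -- Any `g` sends `i` to `±i`, so on `K(i)` it agrees with the identity or with `σ`.
    refine ⟨fun hσx ↦ (IsGalois.mem_bot_iff_fixed x).2 fun g ↦ ?_, apply_of_mem_bot σ⟩
    have hg : g i ^ 2 = i ^ 2 := by rw [← map_pow, hi, map_neg, map_one]
    rcases sq_eq_sq_iff_eq_or_eq_neg.1 hg with hg | hg
    · exact IntermediateField.apply_eq_apply_of_mem_adjoin (σ := g) (τ := 1)
        (by rintro y rfl; simpa using hg) hx
    · exact (IntermediateField.apply_eq_apply_of_mem_adjoin (σ := g) (τ := σ)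
        (by rintro y rfl; rw [hg, hσ]) hx).trans hσx

/-- If `-1` is not a square in `K` and `K(i)` contains a root of unity of order `2 ^ (n + 1)`, then
the automorphism group of `K(i, π ^ (1 / 2 ^ n))` is dihedral. -/
theorem IsTameSquareClassPair.isDihedralExtension [FiniteDimensional K L]
    (hK : IsTameSquareClassPair K u π) (hneg : ∀ x : K, x ^ 2 ≠ -1) (hn : 2 ≤ n) {i ρ ξ : L}
    (hi : i ^ 2 = -1) (hρ : ρ ^ 2 ^ n = algebraMap K L π) (hξ : IsPrimitiveRoot ξ (2 ^ (n + 1)))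
    (hξi : ξ ∈ K⟮i⟯) (htop : adjoin K {i, ρ} = ⊤) :
    IsDihedralExtension K L ∧ Module.finrank K L = 2 ^ (n + 1) := by
  have h2 : (2 : L) ≠ 0 := by
    rw [← map_ofNat (algebraMap K L)]
    simpa using hK.two_ne_zero
  have hζ : IsPrimitiveRoot (ξ ^ 2) (2 ^ n) := hξ.pow (by positivity) (pow_succ' 2 n)
  have : IsGalois K L :=
    isGalois_of_adjoin_pair_eq_top hK.two_ne_zero hK.right_ne_zero hn hi hρ hζ htop
  have hu : u = -1 := hK.left_eq.resolve_right fun ⟨w, hw⟩ ↦ hneg w hw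
  have hiu : i ^ 2 = algebraMap K L u := by rw [hi, hu, map_neg, map_one]
  have hi0 : i ≠ 0 := by
    rintro rfl
    simp at hi
  have hρ0 : ρ ≠ 0 := by
    rintro rfl
    rw [zero_pow (by positivity)] at hρ
    exact hK.right_ne_zero ((map_eq_zero _).1 hρ.symm)
  have happly : ∀ g : L ≃ₐ[K] L, g i = i ∨ g i = -i := fun g ↦
    sq_eq_sq_iff_eq_or_eq_neg.1 (by rw [← map_pow, hi, map_neg, map_one])
  have hext : ∀ g g' : L ≃ₐ[K] L, g i = g' i → g ρ = g' ρ → g = g' := by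
    intro g g' h1 h3
    ext x
    refine IntermediateField.apply_eq_apply_of_mem_adjoin (S := {i, ρ}) ?_
      (by rw [htop]; exact IntermediateField.mem_top)
    rintro y (rfl | rfl)
    · exact h1
    · exact h3
  obtain ⟨σ₀, hσ₀⟩ : ∃ σ₀ : L ≃ₐ[K] L, σ₀ i = -i := by
    by_contra! h
    obtain ⟨x, hx⟩ := IntermediateField.mem_bot.1
      ((IsGalois.mem_bot_iff_fixed (F := K) i).2 fun g ↦ (happly g).resolve_right (h g))
    refine hneg x ((algebraMap K L).injective ?_)
    rw [map_pow, hx, hi, map_neg, map_one]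
  have hstep := isQuadraticStep_adjoin_of_sq_eq_neg_one hi0 hi hσ₀
  have hpow : 2 ^ n = 2 ^ (n - 1) * 2 := by
    rw [← pow_succ, Nat.sub_add_cancel (by omega)]
  -- A square root of `π` in `K(i)` would have norm `±π`, and neither is a norm.
  have hy : ρ ^ 2 ^ (n - 1) ∉ K⟮i⟯ := by
    intro hy
    obtain ⟨t, ht⟩ := IntermediateField.mem_bot.1 (hstep.mul_conj_mem hy)
    have hsq : (ρ ^ 2 ^ (n - 1)) ^ 2 = algebraMap K L π := by rw [← pow_mul, ← hpow, hρ]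
    have ht2 : t ^ 2 = π ^ 2 := by
      apply (algebraMap K L).injective
      rw [map_pow, ht, mul_pow, ← map_pow, hsq, AlgEquiv.commutes, map_pow, sq]
    rcases sq_eq_sq_iff_eq_or_eq_neg.1 ht2 with rfl | rfl
    · exact hK.pow_mul_ne hstep hiu hy (t := 1) (m := 0) (one_pow _) 0 (by rw [← ht]; simp)
    · exact hK.pow_mul_ne hstep hiu hy (t := -1) (m := 1) (by norm_num) 0 (by rw [← ht]; simp)
  obtain ⟨τ, hτ, hτy⟩ : ∃ τ : L ≃ₐ[K] L, τ i = i ∧ τ (ρ ^ 2 ^ (n - 1)) ≠ ρ ^ 2 ^ (n - 1) := by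
    by_contra! h
    apply hy
    rw [← IsGalois.fixedField_fixingSubgroup K⟮i⟯, IntermediateField.mem_fixedField_iff]
    exact fun g hg ↦ h g ((IntermediateField.mem_fixingSubgroup_iff _ _).1 hg i
      (IntermediateField.mem_adjoin_simple_self K i))
  have hratio : ∀ g : L ≃ₐ[K] L, ∃ k, g ρ = (ξ ^ 2) ^ k * ρ := by
    intro g
    obtain ⟨k, -, hk⟩ := hζ.eq_pow_of_pow_eq_one (ξ := g ρ / ρ) (by
      rw [div_pow, ← map_pow, hρ, AlgEquiv.commutes, ← hρ,
        div_self (pow_ne_zero _ hρ0)])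
    exact ⟨k, by rw [hk]; field_simp⟩
  obtain ⟨l, hl⟩ := hratio τ
  obtain ⟨ω, hω⟩ : ∃ ω, ω = (ξ ^ 2) ^ l := ⟨_, rfl⟩
  rw [← hω] at hl
  have hωi : ω ∈ K⟮i⟯ := hω ▸ pow_mem (pow_mem hξi _) _
  have hω1 : ω ^ 2 ^ n = 1 := by rw [hω, ← pow_mul, mul_comm l, pow_mul, hζ.pow_eq_one, one_pow]
  have hωneg : ω ^ 2 ^ (n - 1) = -1 := by
    have h1 : (ω ^ 2 ^ (n - 1)) ^ 2 = 1 := by rw [← pow_mul, ← hpow, hω1]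
    refine (sq_eq_one_iff.1 h1).resolve_left fun h3 ↦ hτy ?_
    rw [map_pow, hl, mul_pow, h3, one_mul]
  have hωp : IsPrimitiveRoot ω (2 ^ n) := by
    have := isPrimitiveRoot_two_pow_of_pow_eq_neg_one h2 hωneg
    rwa [Nat.sub_add_cancel (by omega)] at this
  -- The norm of `ξ` is a 2-power root of unity in `K`, so `±1`; hence `ξ²` and its power `ω` have
  -- norm `1`. Here the order `2^(n+1)` of `ξ` matters: `ω` must be a power of a square.
  have hσ₀ω : ω * σ₀ ω = 1 := by
    obtain ⟨t, ht⟩ := IntermediateField.mem_bot.1 (hstep.mul_conj_mem hξi)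
    have ht1 : t ^ 2 ^ (n + 1) = 1 := by
      apply (algebraMap K L).injective
      rw [map_pow, ht, mul_pow, ← map_pow, hξ.pow_eq_one, map_one, map_one, one_mul]
    have h1 : (ξ * σ₀ ξ) ^ 2 = 1 := by
      rw [← ht]
      rcases eq_one_or_eq_neg_one_of_pow_two_pow_eq_one hneg ht1 with rfl | rfl <;> simp
    rw [hω, map_pow, map_pow, ← mul_pow, ← mul_pow, h1, one_pow]
  have hτω : τ ω = ω := IntermediateField.apply_eq_apply_of_mem_adjoin (σ := τ) (τ := 1)
    (by rintro y rfl; simpa using hτ) hωi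
  have hτi : ∀ k : ℕ, (τ ^ k) i = i := by
    intro k
    induction k with
    | zero => simp
    | succ k ih => rw [pow_succ, AlgEquiv.mul_apply, hτ, ih]
  have hτρ : ∀ k : ℕ, (τ ^ k) ρ = ω ^ k * ρ := by
    intro k
    induction k with
    | zero => simp
    | succ k ih => rw [pow_succ', AlgEquiv.mul_apply, ih, map_mul, map_pow, hτω, hl]; ring
  obtain ⟨σ, hσi, hσρ⟩ : ∃ σ : L ≃ₐ[K] L, σ i = -i ∧ σ ρ = ρ := by
    obtain ⟨k, hk⟩ := hratio σ₀
    obtain ⟨j, -, hj⟩ := hωp.eq_pow_of_pow_eq_one (ξ := (ξ ^ 2) ^ k) (by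
      rw [← pow_mul, mul_comm k, pow_mul, hζ.pow_eq_one, one_pow])
    -- A rotation corrects `σ₀` so that the conjugation fixes `ρ`.
    refine ⟨(τ ^ j)⁻¹ * σ₀, ?_, ?_⟩
    · rw [AlgEquiv.mul_apply, hσ₀, AlgEquiv.aut_inv, AlgEquiv.symm_apply_eq, map_neg, hτi]
    · rw [AlgEquiv.mul_apply, hk, AlgEquiv.aut_inv, AlgEquiv.symm_apply_eq, hτρ, hj]
  have hσω : ω * σ ω = 1 := by
    rw [IntermediateField.apply_eq_apply_of_mem_adjoin (σ := σ) (τ := σ₀)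
      (by rintro y rfl; rw [hσi, hσ₀]) hωi, hσ₀ω]
  have hτ1 : τ ^ 2 ^ n = 1 :=
    hext _ _ (by rw [hτi, AlgEquiv.one_apply]) (by rw [hτρ, hω1, one_mul, AlgEquiv.one_apply])
  have hσσ : σ * σ = 1 :=
    hext _ _ (by simp [hσi]) (by simp [hσρ])
  have hστ : σ * τ = τ⁻¹ * σ := by
    rw [eq_inv_mul_iff_mul_eq]
    refine hext _ _ ?_ ?_
    · simp [hσi, hτ]
    · simp only [AlgEquiv.mul_apply, hl, map_mul, hσρ]
      have hτσω : τ (σ ω) = σ ω := by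
        have hω0 : ω ≠ 0 := left_ne_zero_of_mul_eq_one hσω
        rw [eq_inv_of_mul_eq_one_right hσω, map_inv₀, hτω]
      rw [hτσω, ← mul_assoc, mul_comm (σ ω), hσω, one_mul]
  obtain ⟨φ, hφr, hφs⟩ := DihedralGroup.exists_monoidHom hτ1 hσσ hστ
  have hbij : Function.Bijective φ := by
    constructor
    · rw [injective_iff_map_eq_one]
      rintro (j | j) hj
      · obtain ⟨k, rfl⟩ := ZMod.natCast_zmod_surjective j
        rw [hφr] at hj
        have h1 := hτρ k
        rw [hj, AlgEquiv.one_apply] at h1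
        have h3 := (hωp.pow_eq_one_iff_dvd k).1 ((mul_eq_right₀ hρ0).1 h1.symm)
        rw [(ZMod.natCast_eq_zero_iff _ _).2 h3, DihedralGroup.r_zero]
      · obtain ⟨k, rfl⟩ := ZMod.natCast_zmod_surjective j
        rw [hφs] at hj
        have h1 := congrArg (fun g : L ≃ₐ[K] L ↦ g i) hj
        simp only [AlgEquiv.mul_apply, hτi, hσi, AlgEquiv.one_apply] at h1
        exact (mul_ne_zero h2 hi0 (by linear_combination -h1)).elim
    · intro g
      have hrot : ∀ g : L ≃ₐ[K] L, g i = i → ∃ k : ℕ, g = τ ^ k := by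
        intro g hg
        obtain ⟨k, hk⟩ := hratio g
        obtain ⟨j, -, hj⟩ := hωp.eq_pow_of_pow_eq_one (ξ := (ξ ^ 2) ^ k) (by
          rw [← pow_mul, mul_comm k, pow_mul, hζ.pow_eq_one, one_pow])
        exact ⟨j, hext _ _ (by rw [hg, hτi]) (by rw [hk, hτρ, hj])⟩
      rcases happly g with hg | hg
      · obtain ⟨k, rfl⟩ := hrot g hg
        exact ⟨.r k, hφr k⟩
      · obtain ⟨k, hk⟩ := hrot (σ * g) (by rw [AlgEquiv.mul_apply, hg, map_neg, hσi, neg_neg])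
        exact ⟨.sr k, by rw [hφs, ← hk, ← mul_assoc, hσσ, one_mul]⟩
  have e : DihedralGroup (2 ^ n) ≃* (L ≃ₐ[K] L) := MulEquiv.ofBijective φ hbij
  refine ⟨⟨this, 2 ^ n, ?_, ⟨e.symm⟩⟩, ?_⟩
  · exact (Nat.pow_le_pow_right (by norm_num) hn).trans' (by norm_num)
  · rw [← IsGalois.card_aut_eq_finrank, ← Nat.card_congr e.toEquiv, DihedralGroup.nat_card,
      pow_succ']

end Converse

/-- The degree is the group order `2m`, which forces `m = 2^n`. -/
theorem exists_mulEquiv_dihedralGroup_of_finrank {K L : Type*} [Field K] [Field L] [Algebra K L]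
    {n : ℕ} (h : IsDihedralExtension K L) (hL : Module.finrank K L = 2 ^ (n + 1)) :
    FiniteDimensional K L ∧ IsGalois K L ∧
      Nonempty ((L ≃ₐ[K] L) ≃* DihedralGroup (2 ^ n)) := by
  have hfin : FiniteDimensional K L := .of_finrank_pos (by rw [hL]; positivity)
  obtain ⟨hgal, m, -, ⟨e⟩⟩ := h
  have hm : 2 * m = 2 * 2 ^ n := by
    rw [← DihedralGroup.nat_card, ← Nat.card_congr e.toEquiv, IsGalois.card_aut_eq_finrank, hL,
      pow_succ']
  obtain rfl : m = 2 ^ n := by omega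
  exact ⟨hfin, hgal, ⟨e⟩⟩

/-! ### Passage to the algebraic closure -/

section Assembly

variable {K Ω : Type*} [Field K] [Field Ω] [Algebra K Ω] {i : Ω}

theorem finiteDimensional_adjoin_pair_of_pow_eq {n : ℕ} {a : K} (hn : n ≠ 0) {r : Ω}
    (hi : i ^ 2 = -1) (hr : r ^ n = algebraMap K Ω a) : FiniteDimensional K K⟮i, r⟯ := by
  refine IntermediateField.finiteDimensional_adjoin ?_
  rintro x (rfl | rfl)
  · exact .of_pow two_pos (by rw [hi]; exact isIntegral_one.neg)
  · exact .of_pow (Nat.pos_of_ne_zero hn) (by rw [hr]; exact isIntegral_algebraMap)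

theorem adjoin_pair_eq_top_of_coe {r : Ω} {i' r' : K⟮i, r⟯} (hi : (i' : Ω) = i)
    (hr : (r' : Ω) = r) : K⟮i', r'⟯ = ⊤ := by
  apply IntermediateField.lift_injective
  rw [IntermediateField.lift_adjoin, IntermediateField.lift_top, Set.image_pair, hi, hr]

theorem exists_isGreatest_isPrimitiveRoot_two_pow {R : Type*} [CommRing R] [IsDomain R]
    [IsDiscreteValuationRing R] [Finite (IsLocalRing.ResidueField R)] [Algebra R K]
    [IsFractionRing R K] (hchar : ringChar (IsLocalRing.ResidueField R) ≠ 2) (h2 : (2 : K) ≠ 0)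
    (hi : i ^ 2 = -1) :
    ∃ d, IsGreatest {k : ℕ | ∃ ζ ∈ K⟮i⟯, IsPrimitiveRoot ζ (2 ^ k)} d := by
  have hint : IsIntegral K i := .of_pow two_pos (by rw [hi]; exact isIntegral_one.neg)
  have : FiniteDimensional K K⟮i⟯ := IntermediateField.adjoin.finiteDimensional hint
  have : Algebra.IsSeparable K K⟮i⟯ := by
    rw [IntermediateField.isSeparable_adjoin_simple_iff_isSeparable]
    refine (Polynomial.separable_X_pow_sub_C (n := 2) (-1 : K) (by exact_mod_cast h2)
      (by simp)).of_dvd (minpoly.dvd K i ?_)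
    simp [hi]
  obtain ⟨N, hN⟩ := exists_bound_isPrimitiveRoot_two_pow (R := R) (K := K) hchar K⟮i⟯
  have hbdd : BddAbove {k : ℕ | ∃ ζ ∈ K⟮i⟯, IsPrimitiveRoot ζ (2 ^ k)} := by
    refine ⟨N, ?_⟩
    rintro k ⟨ζ, hζ, hζk⟩
    exact hN k ⟨ζ, hζ⟩ (hζk.of_map_of_injective (f := K⟮i⟯.val) Subtype.val_injective)
  refine ⟨_, Nat.sSup_mem ⟨0, 1, one_mem _, by simp⟩ hbdd, fun k hk ↦ le_csSup hbdd hk⟩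

theorem exists_isPrimitiveRoot_two_pow_iff_lt {d : ℕ}
    (hd : IsGreatest {k : ℕ | ∃ ζ ∈ K⟮i⟯, IsPrimitiveRoot ζ (2 ^ k)} d) {n : ℕ} :
    (∃ ξ ∈ K⟮i⟯, IsPrimitiveRoot ξ (2 ^ (n + 1))) ↔ n < d := by
  refine ⟨fun h ↦ hd.2 h, fun hn ↦ ?_⟩
  obtain ⟨ζ, hζ, hζd⟩ := hd.1
  exact ⟨ζ ^ 2 ^ (d - (n + 1)), pow_mem hζ _, hζd.pow (by positivity)
    (by rw [← pow_add]; congr 1; omega)⟩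

variable {u π : K} {n : ℕ}

theorem IsTameSquareClassPair.isDihedralExtension_adjoin_pair
    (hK : IsTameSquareClassPair K u π) (hn : 2 ≤ n) (hi : i ^ 2 = -1) (hneg : ∀ x : K, x ^ 2 ≠ -1)
    (hξ : ∃ ξ ∈ K⟮i⟯, IsPrimitiveRoot ξ (2 ^ (n + 1))) {r : Ω}
    (hr : r ^ 2 ^ n = algebraMap K Ω π) :
    IsDihedralExtension K K⟮i, r⟯ ∧ Module.finrank K K⟮i, r⟯ = 2 ^ (n + 1) := by
  obtain ⟨ξ, hξi, hξ⟩ := hξ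
  have := finiteDimensional_adjoin_pair_of_pow_eq (by positivity) hi hr
  have hi_mem : i ∈ K⟮i, r⟯ := IntermediateField.subset_adjoin _ _ (by simp)
  have hr_mem : r ∈ K⟮i, r⟯ := IntermediateField.subset_adjoin _ _ (by simp)
  have hmap : (K⟮(⟨i, hi_mem⟩ : K⟮i, r⟯)⟯).map K⟮i, r⟯.val = K⟮i⟯ := by
    rw [IntermediateField.adjoin_map, Set.image_singleton]
    rfl
  rw [← hmap] at hξi
  obtain ⟨ξ', hξ', rfl⟩ := hξi
  refine hK.isDihedralExtension hneg hn (i := ⟨i, hi_mem⟩) (ρ := ⟨r, hr_mem⟩) (ξ := ξ')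
    (Subtype.ext hi) (Subtype.ext hr) ?_ hξ' (adjoin_pair_eq_top_of_coe rfl rfl)
  exact IsPrimitiveRoot.of_map_of_injective (f := K⟮i, r⟯.val) hξ Subtype.val_injective

variable {L : Type*} [Field L] [Algebra K L] [IsAlgClosed Ω]

/-- An embedding of `L` in `Ω` has image containing `±i` and a `2^n`-th root of `π`. Any other such
root differs by a power of `η²`, so the image contains `K(i, r)`; the degrees agree, so the two are
equal. -/
theorem IsTameSquareClassPair.of_isDihedralExtension (hK : IsTameSquareClassPair K u π)
    (hn : 2 ≤ n) (hi : i ^ 2 = -1) (h : IsDihedralExtension K L)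
    (hL : Module.finrank K L = 2 ^ (n + 1)) :
    (∀ x : K, x ^ 2 ≠ -1) ∧ (∃ ξ ∈ K⟮i⟯, IsPrimitiveRoot ξ (2 ^ (n + 1))) ∧
      ∀ r : Ω, r ^ 2 ^ n = algebraMap K Ω π → Nonempty (L ≃ₐ[K] K⟮i, r⟯) := by
  obtain ⟨_, _, ⟨e⟩⟩ := exists_mulEquiv_dihedralGroup_of_finrank h hL
  obtain ⟨hneg, j, η, ρ, hj, hη, hηj, hρ⟩ :=
    hK.exists_generators_of_mulEquiv_dihedralGroup hn e
  let f : L →ₐ[K] Ω := IsAlgClosed.lift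
  have hfη : IsPrimitiveRoot (f η) (2 ^ (n + 1)) := hη.map_of_injective f.injective
  have hfj : i = f j ∨ i = -f j := by
    refine sq_eq_sq_iff_eq_or_eq_neg.1 ?_
    rw [← map_pow, hj, hi, map_neg, map_one]
  have hfηi : f η ∈ K⟮i⟯ := by
    have h1 : f η ∈ (K⟮j⟯).map f := ⟨η, hηj, rfl⟩
    rw [IntermediateField.adjoin_map, Set.image_singleton] at h1
    refine IntermediateField.adjoin_simple_le_iff.2 ?_ h1
    have hii := IntermediateField.mem_adjoin_simple_self K i
    rcases hfj with hfj | hfj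
    · rwa [← hfj]
    · rw [← neg_eq_iff_eq_neg.2 hfj]
      exact neg_mem hii
  refine ⟨hneg, ⟨f η, hfηi, hfη⟩, fun r hr ↦ ?_⟩
  have hr0 : f ρ ≠ 0 := by
    intro h0
    have h1 : f ρ ^ 2 ^ n = algebraMap K Ω π := by rw [← map_pow, hρ, f.commutes]
    rw [h0, zero_pow (by positivity)] at h1
    exact hK.right_ne_zero ((map_eq_zero _).1 h1.symm)
  have hle : K⟮i, r⟯ ≤ f.fieldRange := by
    rw [IntermediateField.adjoin_le_iff]
    rintro x (rfl | rfl)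
    · rcases hfj with hfj | hfj <;> rw [hfj]
      · exact ⟨j, rfl⟩
      · exact ⟨-j, map_neg f j⟩
    · have hζ : IsPrimitiveRoot (f η ^ 2) (2 ^ n) := hfη.pow (by positivity) (pow_succ' 2 n)
      obtain ⟨k, -, hk⟩ := hζ.eq_pow_of_pow_eq_one (ξ := x / f ρ) (by
        rw [div_pow, ← map_pow f, hρ, f.commutes, hr, div_self]
        simpa using hK.right_ne_zero)
      refine ⟨(η ^ 2) ^ k * ρ, ?_⟩
      change f _ = x
      rw [map_mul, map_pow, map_pow, hk, div_mul_cancel₀ _ hr0]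
  have hfin : Module.finrank K f.fieldRange = 2 ^ (n + 1) := by
    rw [← hL]
    exact (AlgEquiv.ofInjectiveField f).toLinearEquiv.finrank_eq.symm
  have : FiniteDimensional K f.fieldRange := .of_finrank_pos (by rw [hfin]; positivity)
  have heq : K⟮i, r⟯ = f.fieldRange := IntermediateField.eq_of_le_of_finrank_eq hle (by
    rw [hfin, (hK.isDihedralExtension_adjoin_pair hn hi hneg ⟨f η, hfηi, hfη⟩ hr).2])
  exact ⟨(AlgEquiv.ofInjectiveField f).trans (IntermediateField.equivOfEq heq.symm)⟩

end Assembly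

theorem mainTheorem10 (K₀ : Type u) [Field K₀] [ValuativeRel K₀] [TopologicalSpace K₀]
    [IsNonarchimedeanLocalField K₀] (hchar : ringChar 𝓀[K₀] ≠ 2)
    (π : 𝒪[K₀]) (hπ : Irreducible π)
    (i : AlgebraicClosure K₀) (hi : i ^ 2 = -1) :
    ∃ d : ℕ,
      IsGreatest {k : ℕ | ∃ ζ ∈ K₀⟮i⟯, IsPrimitiveRoot ζ (2 ^ k)} d ∧
      ∀ n : ℕ, 2 ≤ n →
        ((∃ (L : Type u) (_ : Field L) (_ : Algebra K₀ L),
            IsDihedralExtension K₀ L ∧ Module.finrank K₀ L = 2 ^ (n + 1)) ↔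
          (¬ ∃ x : K₀, x ^ 2 = -1) ∧ n < d) ∧
        ((¬ ∃ x : K₀, x ^ 2 = -1) ∧ n < d →
          ∀ r : AlgebraicClosure K₀,
            r ^ (2 ^ n) = algebraMap K₀ (AlgebraicClosure K₀) (π : K₀) →
            IsDihedralExtension K₀ K₀⟮i, r⟯ ∧
            Module.finrank K₀ K₀⟮i, r⟯ = 2 ^ (n + 1) ∧
            ∀ (L : Type u) [Field L] [Algebra K₀ L],
              IsDihedralExtension K₀ L → Module.finrank K₀ L = 2 ^ (n + 1) →
              Nonempty (L ≃ₐ[K₀] K₀⟮i, r⟯)) := by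
  have := IsNonarchimedeanLocalField.henselianLocalRing_integer K₀
  obtain ⟨u, hK⟩ := exists_isTameSquareClassPair K₀ hchar hπ
  change IsTameSquareClassPair K₀ u (π : K₀) at hK
  obtain ⟨d, hd⟩ := exists_isGreatest_isPrimitiveRoot_two_pow hchar hK.two_ne_zero hi
  refine ⟨d, hd, fun n hn ↦ ?_⟩
  rw [not_exists, ← exists_isPrimitiveRoot_two_pow_iff_lt hd]
  refine ⟨⟨?_, fun h ↦ ?_⟩, fun h r hr ↦ ?_⟩
  · rintro ⟨L, _, _, hL, hfin⟩
    have h := hK.of_isDihedralExtension hn hi hL hfin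
    exact ⟨h.1, h.2.1⟩
  · obtain ⟨r, hr⟩ := IsAlgClosed.exists_pow_nat_eq
      (algebraMap K₀ (AlgebraicClosure K₀) (π : K₀)) (n := 2 ^ n) (by positivity)
    exact ⟨K₀⟮i, r⟯, inferInstance, inferInstance,
      hK.isDihedralExtension_adjoin_pair hn hi h.1 h.2 hr⟩
  · have h1 := hK.isDihedralExtension_adjoin_pair hn hi h.1 h.2 hr
    exact ⟨h1.1, h1.2, fun L _ _ hL hfin ↦
      (hK.of_isDihedralExtension hn hi hL hfin).2.2 r hr⟩
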